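/- **Theorem 4 (complexity of MFTP).** Let $D=(V,E)$ be a finite directed graph (loops allowed, $V\neq\emptyset$) and let $S\subseteq V$ be a set of target nodes. The MFTP network $D^{(N)}=(V^{(N)},E^{(N)})$ has the vertices $v_s$, $v_t$ and two copies $v^{\rm in},v^{\rm out}$ of each $v\in V$; its edges are $(v_t,v^{\rm out})$ and $(v^{\rm in},v_s)$ for $v\in S$, $(v^{\rm in},v^{\rm out})$ for $v\in V\setminus S$, and $(v_i^{\rm out},v_j^{\rm in})$ for $(v_i,v_j)\in E$; all edges have capacity $1$, and a flow of maximum value from $v_t$ to $v_s$ is sought. (a) $D^{(N)}$ is a unit network of type 2: all edge capacities are $1$, and every vertex other than $v_t$ and $v_s$ has exactly one incoming edge or exactly one outgoing edge. (b) Consider Dinic's algorithm (levels by breadth-first search in the residual network, a blocking flow of the level graph by depth-first search with current-arc pointers, repeated until the sink is unreachable), written as one fixed program for a unit-cost random access machine. The program receives a network as a list of edges, with any numbering of the vertices and of the edges. There is an absolute constant $C$ such that for all $D$, $S$ and all numberings the program, started on $D^{(N)}$, halts with a flow that is maximum among all real-valued feasible flows, after at most $$C\,|V^{(N)}|^{1/2}\,|E^{(N)}|$$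 units of time. If moreover $|V|\le 2|E|$ (for instance, if every node of $D$ is an endpoint of some edge), the running time is also at most $C\,|V|^{1/2}|E|$. -/

import Mathlib

open scoped BigOperators

/-! ### A unit-cost random access machine

The memory consists of scalar registers (indexed by `X`) and of one-dimensional arrays (indexed by
`A`), all holding natural numbers; a program uses a fixed, finite number of registers and arrays.
Reading or writing a register or an array cell, adding, subtracting, comparing and branching each
take one unit of time. -/

namespace RAM

/-- Memory contents. -/
structure Store (X A : Type) where
  reg : X → ℕ
  arr : A → ℕ → ℕ

/-- Arithmetic expressions; `read a e` is the cell of the array `a` with index `e`. Subtraction is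
truncated at `0`. -/
inductive Expr (X A : Type) where
  | const (k : ℕ)
  | var (x : X)
  | read (a : A) (e : Expr X A)
  | add (e₁ e₂ : Expr X A)
  | sub (e₁ e₂ : Expr X A)

/-- Tests. -/
inductive Cond (X A : Type) where
  | lt (e₁ e₂ : Expr X A)
  | eq (e₁ e₂ : Expr X A)
  | and (b₁ b₂ : Cond X A)
  | not (b : Cond X A)

/-- Programs. -/
inductive Prog (X A : Type) where
  | assign (x : X) (e : Expr X A)
  | write (a : A) (i e : Expr X A)
  | seq (p q : Prog X A)
  | ite (b : Cond X A) (p q : Prog X A)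
  | loop (b : Cond X A) (p : Prog X A)

section Semantics

variable {X A : Type}

/-- The value of an expression. -/
def Expr.eval (σ : Store X A) : Expr X A → ℕ
  | .const k => k
  | .var x => σ.reg x
  | .read a e => σ.arr a (e.eval σ)
  | .add e₁ e₂ => e₁.eval σ + e₂.eval σ
  | .sub e₁ e₂ => e₁.eval σ - e₂.eval σ

/-- The time for evaluating an expression: one unit for each constant, register, array access and
arithmetic operation. -/
def Expr.cost : Expr X A → ℕ
  | .const _ => 1
  | .var _ => 1
  | .read _ e => 1 + e.cost
  | .add e₁ e₂ => 1 + e₁.cost + e₂.cost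
  | .sub e₁ e₂ => 1 + e₁.cost + e₂.cost

/-- The truth value of a test. -/
def Cond.Holds (σ : Store X A) : Cond X A → Prop
  | .lt e₁ e₂ => e₁.eval σ < e₂.eval σ
  | .eq e₁ e₂ => e₁.eval σ = e₂.eval σ
  | .and b₁ b₂ => b₁.Holds σ ∧ b₂.Holds σ
  | .not b => ¬ b.Holds σ

/-- The time for evaluating a test. -/
def Cond.cost : Cond X A → ℕ
  | .lt e₁ e₂ => 1 + e₁.cost + e₂.cost
  | .eq e₁ e₂ => 1 + e₁.cost + e₂.cost
  | .and b₁ b₂ => 1 + b₁.cost + b₂.cost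
  | .not b => 1 + b.cost

/-- The memory after a register has been overwritten. -/
def Store.setReg [DecidableEq X] (σ : Store X A) (x : X) (k : ℕ) : Store X A :=
  { σ with reg := Function.update σ.reg x k }

/-- The memory after an array cell has been overwritten. -/
def Store.setCell [DecidableEq A] (σ : Store X A) (a : A) (i k : ℕ) : Store X A :=
  { σ with arr := Function.update σ.arr a (Function.update (σ.arr a) i k) }

/-- `Runs p σ τ σ'`: started with memory `σ`, the program `p` halts after exactly `τ` units of time
with memory `σ'`. -/
inductive Runs [DecidableEq X] [DecidableEq A] :
    Prog X A → Store X A → ℕ → Store X A → Prop where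
  | assign (x : X) (e : Expr X A) (σ : Store X A) :
      Runs (.assign x e) σ (1 + e.cost) (σ.setReg x (e.eval σ))
  | write (a : A) (i e : Expr X A) (σ : Store X A) :
      Runs (.write a i e) σ (1 + i.cost + e.cost) (σ.setCell a (i.eval σ) (e.eval σ))
  | seq {p q : Prog X A} {σ σ₁ σ₂ : Store X A} {τ₁ τ₂ : ℕ} :
      Runs p σ τ₁ σ₁ → Runs q σ₁ τ₂ σ₂ → Runs (.seq p q) σ (τ₁ + τ₂) σ₂
  | iteTrue {b : Cond X A} {p q : Prog X A} {σ σ' : Store X A} {τ : ℕ} :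
      b.Holds σ → Runs p σ τ σ' → Runs (.ite b p q) σ (1 + b.cost + τ) σ'
  | iteFalse {b : Cond X A} {p q : Prog X A} {σ σ' : Store X A} {τ : ℕ} :
      ¬ b.Holds σ → Runs q σ τ σ' → Runs (.ite b p q) σ (1 + b.cost + τ) σ'
  | loopStop {b : Cond X A} {p : Prog X A} {σ : Store X A} :
      ¬ b.Holds σ → Runs (.loop b p) σ (1 + b.cost) σ
  | loopStep {b : Cond X A} {p : Prog X A} {σ σ₁ σ₂ : Store X A} {τ₁ τ₂ : ℕ} :
      b.Holds σ → Runs p σ τ₁ σ₁ → Runs (.loop b p) σ₁ τ₂ σ₂ →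
      Runs (.loop b p) σ (1 + b.cost + τ₁ + τ₂) σ₂

/-- Running time and final memory are determined by the program and the initial memory. -/
theorem Runs.unique [DecidableEq X] [DecidableEq A] {p : Prog X A} {σ σ₁ σ₂ : Store X A}
    {τ₁ τ₂ : ℕ} (h₁ : Runs p σ τ₁ σ₁) (h₂ : Runs p σ τ₂ σ₂) : τ₁ = τ₂ ∧ σ₁ = σ₂ := by
  induction h₁ generalizing τ₂ σ₂ with
  | assign x e σ => cases h₂; exact ⟨rfl, rfl⟩
  | write a i e σ => cases h₂; exact ⟨rfl, rfl⟩
  | seq _ _ ih₁ ih₂ =>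
    cases h₂ with
    | seq k₁ k₂ =>
      obtain ⟨rfl, rfl⟩ := ih₁ k₁
      obtain ⟨rfl, rfl⟩ := ih₂ k₂
      exact ⟨rfl, rfl⟩
  | iteTrue hb _ ih =>
    cases h₂ with
    | iteTrue _ k => obtain ⟨rfl, rfl⟩ := ih k; exact ⟨rfl, rfl⟩
    | iteFalse hb' _ => exact absurd hb hb'
  | iteFalse hb _ ih =>
    cases h₂ with
    | iteTrue hb' _ => exact absurd hb' hb
    | iteFalse _ k => obtain ⟨rfl, rfl⟩ := ih k; exact ⟨rfl, rfl⟩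
  | loopStop hb =>
    cases h₂ with
    | loopStop _ => exact ⟨rfl, rfl⟩
    | loopStep hb' _ _ => exact absurd hb' hb
  | loopStep hb _ _ ih₁ ih₂ =>
    cases h₂ with
    | loopStop hb' => exact absurd hb hb'
    | loopStep _ k₁ k₂ =>
      obtain ⟨rfl, rfl⟩ := ih₁ k₁
      obtain ⟨rfl, rfl⟩ := ih₂ k₂
      exact ⟨rfl, rfl⟩

end Semantics

end RAM

/-! ### Flow networks -/

/-- A network with integral capacities: a directed graph with a source of in-degree zero, a sink of
out-degree zero, and a capacity for each edge. -/
structure FlowNetwork (W : Type*) where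
  edges : Finset (W × W)
  cap : W × W → ℕ
  source : W
  sink : W
  source_ne_sink : source ≠ sink
  no_edge_into_source : ∀ e ∈ edges, e.2 ≠ source
  no_edge_out_of_sink : ∀ e ∈ edges, e.1 ≠ sink

namespace FlowNetwork

variable {W : Type*} [DecidableEq W]

/-- The edges that leave a vertex. -/
def outEdges (D : FlowNetwork W) (w : W) : Finset (W × W) := D.edges.filter fun e => e.1 = w

/-- The edges that enter a vertex. -/
def inEdges (D : FlowNetwork W) (w : W) : Finset (W × W) := D.edges.filter fun e => e.2 = w

/-- Real-valued flows that obey the capacity and the conservation constraints. -/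
def IsFeasibleFlow (D : FlowNetwork W) (f : W × W → ℝ) : Prop :=
  (∀ e ∈ D.edges, 0 ≤ f e ∧ f e ≤ D.cap e) ∧
  ∀ w, w ≠ D.source → w ≠ D.sink → ∑ e ∈ D.outEdges w, f e = ∑ e ∈ D.inEdges w, f e

/-- The value of a flow. -/
def flowValue (D : FlowNetwork W) (f : W × W → ℝ) : ℝ := ∑ e ∈ D.outEdges D.source, f e

/-- Optimal solutions of the maximum-flow problem. -/
def IsMaximumFlow (D : FlowNetwork W) (f : W × W → ℝ) : Prop :=
  D.IsFeasibleFlow f ∧ ∀ g, D.IsFeasibleFlow g → D.flowValue g ≤ D.flowValue f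

/-- All capacities are one, and every vertex other than the source and the sink has a single edge
entering it or a single edge leaving it. -/
def IsUnitType2 (D : FlowNetwork W) : Prop :=
  (∀ e ∈ D.edges, D.cap e = 1) ∧
  ∀ w, w ≠ D.source → w ≠ D.sink → (D.inEdges w).card = 1 ∨ (D.outEdges w).card = 1

end FlowNetwork

/-! ### The network of MFTP -/

/-- The vertices `v_s`, `v_t`, and the two copies `v^in`, `v^out` of each node `v`. -/
inductive SplitVertex (V : Type*) where
  | vs
  | vt
  | vin (v : V)
  | vout (v : V)
  deriving DecidableEq, Fintype

/-- The network built from a directed graph with edge set `E` (loops are allowed) and a set `S` of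
target nodes. The flow goes from `v_t` to `v_s`. -/
def mftpNetwork {V : Type*} [Fintype V] [DecidableEq V] (E : Finset (V × V)) (S : Finset V) :
    FlowNetwork (SplitVertex V) where
  edges :=
    S.image (fun v => (.vt, .vout v)) ∪ S.image (fun v => (.vin v, .vs)) ∪
    Sᶜ.image (fun v => (.vin v, .vout v)) ∪ E.image (fun e => (.vout e.1, .vin e.2))
  cap := fun _ => 1
  source := .vt
  sink := .vs
  source_ne_sink := by simp
  no_edge_into_source := by
    intro e he
    simp only [Finset.mem_union, Finset.mem_image] at he
    rcases he with ((⟨v, -, rfl⟩ | ⟨v, -, rfl⟩) | ⟨v, -, rfl⟩) | ⟨v, -, rfl⟩ <;> simp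
  no_edge_out_of_sink := by
    intro e he
    simp only [Finset.mem_union, Finset.mem_image] at he
    rcases he with ((⟨v, -, rfl⟩ | ⟨v, -, rfl⟩) | ⟨v, -, rfl⟩) | ⟨v, -, rfl⟩ <;> simp

/-! ### Dinic's algorithm

Vertices are the numbers below `n`, edges the numbers below `m`. The edge `i` gives rise to the
residual arcs `i` (forward) and `i + m` (backward). Arcs that leave a vertex form a linked list, in
which the pointer `a + 1` stands for the arc `a` and the pointer `0` for the end of the list. -/

namespace Dinic

open RAM

/-- The registers: number of vertices, number of edges, source and sink (the input), and working
registers. -/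
inductive Reg where
  | n | m | s | t
  | i | u | v | a | qh | qt | len | b | run
  deriving DecidableEq

/-- The arrays: tail, head and capacity of each edge (the input), the flow on each edge (the
output), and working arrays. -/
inductive Arr where
  | tail | head | cap
  | flow
  | to | res | rev | nxt | first | level | queue | cur | path
  deriving DecidableEq

/-- Sequential composition. -/
local infixr:30 " ;; " => RAM.Prog.seq

instance : Coe Reg (Expr Reg Arr) := ⟨Expr.var⟩
instance : Add (Expr Reg Arr) := ⟨Expr.add⟩
instance : Sub (Expr Reg Arr) := ⟨Expr.sub⟩
instance (k : ℕ) : OfNat (Expr Reg Arr) k := ⟨Expr.const k⟩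

open RAM.Expr (var read)
open RAM.Cond (lt eq and not)
open RAM.Prog (assign write ite loop)

/-- `for i = k, …, e - 1 do p`. -/
def forLoop (k : ℕ) (e : Expr Reg Arr) (p : Prog Reg Arr) : Prog Reg Arr :=
  assign .i (.const k) ;;
  loop (lt (var .i) e) (
    p ;;
    assign .i (var .i + 1))

/-- Build the residual network of the zero flow, with adjacency lists. -/
def build : Prog Reg Arr :=
  forLoop 0 (var .n) (write .first (var .i) 0) ;;
  forLoop 0 (var .m) (
    write .to (var .i) (read .head (var .i)) ;;
    write .res (var .i) (read .cap (var .i)) ;;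
    write .rev (var .i) (var .i + var .m) ;;
    write .nxt (var .i) (read .first (read .tail (var .i))) ;;
    write .first (read .tail (var .i)) (var .i + 1) ;;
    write .to (var .i + var .m) (read .tail (var .i)) ;;
    write .res (var .i + var .m) 0 ;;
    write .rev (var .i + var .m) (var .i) ;;
    write .nxt (var .i + var .m) (read .first (read .head (var .i))) ;;
    write .first (read .head (var .i)) (var .i + var .m + 1))

/-- Breadth-first search from the source along residual arcs of positive capacity. A vertex at
distance `d` from the source gets the level `d + 1`, an unreachable vertex the level `0`. -/
def bfs : Prog Reg Arr :=
  forLoop 0 (var .n) (write .level (var .i) 0) ;;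
  write .level (var .s) 1 ;;
  write .queue 0 (var .s) ;;
  assign .qh 0 ;;
  assign .qt 1 ;;
  loop (lt (var .qh) (var .qt)) (
    assign .u (read .queue (var .qh)) ;;
    assign .qh (var .qh + 1) ;;
    assign .a (read .first (var .u)) ;;
    loop (lt 0 (var .a)) (
      assign .v (read .to (var .a - 1)) ;;
      ite (and (eq (read .level (var .v)) 0) (lt 0 (read .res (var .a - 1))))
        (write .level (var .v) (read .level (var .u) + 1) ;;
         write .queue (var .qt) (var .v) ;;
         assign .qt (var .qt + 1) ;;
         assign .a (read .nxt (var .a - 1)))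
        (assign .a (read .nxt (var .a - 1)))))

/-- Augment the flow along the path that is stored in `path[0], …, path[len - 1]` by its bottleneck
capacity. -/
def augment : Prog Reg Arr :=
  assign .b (read .res (read .path 0)) ;;
  forLoop 1 (var .len)
    (ite (lt (read .res (read .path (var .i))) (var .b))
      (assign .b (read .res (read .path (var .i))))
      (assign .b (var .b))) ;;
  forLoop 0 (var .len) (
    assign .a (read .path (var .i)) ;;
    write .res (var .a) (read .res (var .a) - var .b) ;;
    write .res (read .rev (var .a)) (read .res (read .rev (var .a)) + var .b))

/-- Blocking flow in the level graph: depth-first search from the source with current-arc pointers.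
Arcs that lead to a dead end are discarded; when the sink is reached, the flow is augmented and the
search resumes at the source; the phase ends when the list of the source is exhausted. -/
def blockingFlow : Prog Reg Arr :=
  forLoop 0 (var .n) (write .cur (var .i) (read .first (var .i))) ;;
  assign .len 0 ;;
  assign .u (var .s) ;;
  assign .run 1 ;;
  loop (eq (var .run) 1)
    (ite (eq (var .u) (var .t))
      (augment ;;
       assign .len 0 ;;
       assign .u (var .s))
      (assign .a (read .cur (var .u)) ;;
       ite (eq (var .a) 0)
        (ite (eq (var .len) 0)
          (assign .run 0)
          (assign .len (var .len - 1) ;;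
           assign .u (read .to (read .rev (read .path (var .len)))) ;;
           write .cur (var .u) (read .nxt (read .cur (var .u) - 1))))
        (assign .v (read .to (var .a - 1)) ;;
         ite (and (lt 0 (read .res (var .a - 1)))
                (eq (read .level (var .v)) (read .level (var .u) + 1)))
          (write .path (var .len) (var .a - 1) ;;
           assign .len (var .len + 1) ;;
           assign .u (var .v))
          (write .cur (var .u) (read .nxt (var .a - 1))))))

/-- Dinic's algorithm: as long as the sink can be reached in the residual network, augment by a
blocking flow of the level graph. -/
def program : Prog Reg Arr :=
  build ;;
  bfs ;;
  loop (not (eq (read .level (var .t)) 0)) (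
    blockingFlow ;;
    bfs) ;;
  forLoop 0 (var .m) (write .flow (var .i) (read .res (var .i + var .m)))

section InputOutput

variable {W : Type*} [Fintype W]

/-- The memory `σ` holds the network `D`, given as a list of edges, with respect to a numbering
`num` of its vertices and a numbering `enum` of its edges. All other memory is arbitrary. -/
def Holds (D : FlowNetwork W) (num : W ≃ Fin (Fintype.card W))
    (enum : D.edges ≃ Fin D.edges.card) (σ : Store Reg Arr) : Prop :=
  σ.reg .n = Fintype.card W ∧
  σ.reg .m = D.edges.card ∧
  σ.reg .s = num D.source ∧
  σ.reg .t = num D.sink ∧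
  ∀ e : D.edges,
    σ.arr .tail (enum e) = num e.1.1 ∧
    σ.arr .head (enum e) = num e.1.2 ∧
    σ.arr .cap (enum e) = D.cap e.1

/-- The flow that is stored in the output array. -/
noncomputable def outputFlow [DecidableEq W] (D : FlowNetwork W)
    (enum : D.edges ≃ Fin D.edges.card) (σ : Store Reg Arr) : W × W → ℝ :=
  fun e => if h : e ∈ D.edges then (σ.arr .flow (enum ⟨e, h⟩) : ℝ) else 0

end InputOutput

end Dinic

/-! Dinic's algorithm takes `O(√n)` phases on a unit network of type 2, and each phase takes linear
time.

*Number of phases.* A flow with values `0` and `1` leaves the residual in-degree and out-degree of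
each inner vertex as they are in the network, so each inner vertex still has a single residual arc
into it or a single one out of it. Hence the vertices of any one distance layer between source and
sink give rise to a cut whose residual capacity is at most the size of the layer
(`NumNet.IsLevel.value_le_add_card`). If the sink is so far away that `k` layers lie in between, one
of them has at most `n / k` vertices, and by weak duality the value of the flow can grow by at most
`n / k` (`NumNet.IsLevel.value_le_add_div`). Each phase increases the value by at least one and the
distance of the sink strictly (`NumNet.IsLevel.lt_of_isBlocked`), so there are at most
`k + n / k + O(1)` phases (`terminates_phases`); take `k = ⌊√n⌋`. When the sink is unreachable, the
reachable vertices form a cut without residual capacity, and the flow is maximum among all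
real-valued flows (`NumNet.IsLevel.optimal`).

*Time of a phase.* Breadth-first search scans each vertex once. In the depth-first search each arc
is passed at most once; each arc that is appended to the path is later either passed, on a retreat,
or saturated, on an augmentation, because all capacities are one. The potential `searchTime` turns
this into a linear bound (`terminates_blockingFlow`).

Programs are verified by a calculus of weakest preconditions that also keeps track of time:
`Terminates p Q σ` can be computed by rewriting for programs without loops, and loops are treated
with invariants that mention a potential (`terminates_loop`). The search procedures refer to the
linked lists, the queue and the path in the memory through ghost variables of type `List ℕ`. -/

/-! ### Weakest preconditions with running time -/

namespace RAM

variable {X A : Type}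

theorem Store.setReg_reg [DecidableEq X] (σ : Store X A) (x y : X) (k : ℕ) :
    (σ.setReg x k).reg y = if y = x then k else σ.reg y := by
  simp [Store.setReg, Function.update_apply]

theorem Store.setReg_arr [DecidableEq X] (σ : Store X A) (x : X) (k : ℕ) :
    (σ.setReg x k).arr = σ.arr := rfl

theorem Store.setCell_reg [DecidableEq A] (σ : Store X A) (a : A) (i k : ℕ) :
    (σ.setCell a i k).reg = σ.reg := rfl

theorem Store.setCell_arr [DecidableEq A] (σ : Store X A) (a b : A) (i k : ℕ) :
    (σ.setCell a i k).arr b = if b = a then Function.update (σ.arr a) i k else σ.arr b := by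
  by_cases h : b = a
  · subst h; simp [Store.setCell]
  · simp [Store.setCell, h]

variable [DecidableEq X] [DecidableEq A]

/-- The program `p`, started with memory `σ`, halts, and its running time and final memory
satisfy `Q`. -/
def Terminates (p : Prog X A) (Q : ℕ → Store X A → Prop) (σ : Store X A) : Prop :=
  ∃ τ σ', Runs p σ τ σ' ∧ Q τ σ'

variable {p q : Prog X A} {b : Cond X A} {Q R : ℕ → Store X A → Prop} {σ : Store X A}

theorem Terminates.mono (h : Terminates p Q σ) (hQ : ∀ τ σ', Q τ σ' → R τ σ') :
    Terminates p R σ := by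
  obtain ⟨τ, σ', h₁, h₂⟩ := h
  exact ⟨τ, σ', h₁, hQ _ _ h₂⟩

theorem terminates_assign {x : X} {e : Expr X A} :
    Terminates (.assign x e) Q σ ↔ Q (1 + e.cost) (σ.setReg x (e.eval σ)) := by
  constructor
  · rintro ⟨τ, σ', h, hQ⟩
    cases h
    exact hQ
  · exact fun h => ⟨_, _, .assign .., h⟩

theorem terminates_write {a : A} {i e : Expr X A} :
    Terminates (.write a i e) Q σ ↔
      Q (1 + i.cost + e.cost) (σ.setCell a (i.eval σ) (e.eval σ)) := by
  constructor
  · rintro ⟨τ, σ', h, hQ⟩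
    cases h
    exact hQ
  · exact fun h => ⟨_, _, .write .., h⟩

theorem terminates_seq :
    Terminates (.seq p q) Q σ ↔
      Terminates p (fun τ σ₁ => Terminates q (fun τ' => Q (τ + τ')) σ₁) σ := by
  constructor
  · rintro ⟨τ, σ', h, hQ⟩
    cases h with
    | seq h₁ h₂ => exact ⟨_, _, h₁, _, _, h₂, hQ⟩
  · rintro ⟨τ, σ₁, h₁, τ', σ₂, h₂, hQ⟩
    exact ⟨_, _, .seq h₁ h₂, hQ⟩

theorem terminates_ite :
    Terminates (.ite b p q) Q σ ↔
      (b.Holds σ → Terminates p (fun τ => Q (1 + b.cost + τ)) σ) ∧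
      (¬ b.Holds σ → Terminates q (fun τ => Q (1 + b.cost + τ)) σ) := by
  constructor
  · rintro ⟨τ, σ', h, hQ⟩
    cases h with
    | iteTrue hb h => exact ⟨fun _ => ⟨_, _, h, hQ⟩, fun h => absurd hb h⟩
    | iteFalse hb h => exact ⟨fun h => absurd h hb, fun _ => ⟨_, _, h, hQ⟩⟩
  · rintro ⟨h₁, h₂⟩
    by_cases hb : b.Holds σ
    · obtain ⟨τ, σ', h, hQ⟩ := h₁ hb
      exact ⟨_, _, .iteTrue hb h, hQ⟩
    · obtain ⟨τ, σ', h, hQ⟩ := h₂ hb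
      exact ⟨_, _, .iteFalse hb h, hQ⟩

/-- The amortized analysis of a loop: `I φ σ` is an invariant that mentions a potential `φ`, and
each round is paid for by a decrease of the potential. -/
theorem terminates_loop (I : ℕ → Store X A → Prop)
    (hstep : ∀ φ σ, I φ σ → b.Holds σ →
      Terminates p (fun τ σ' => ∃ φ', I φ' σ' ∧ 1 + b.cost + τ + φ' ≤ φ) σ)
    {φ : ℕ} (hI : I φ σ) :
    Terminates (.loop b p)
      (fun τ σ' => ∃ φ', I φ' σ' ∧ ¬ b.Holds σ' ∧ τ + φ' ≤ φ + (1 + b.cost)) σ := by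
  induction φ using Nat.strong_induction_on generalizing σ with
  | _ φ ih =>
    by_cases hb : b.Holds σ
    · obtain ⟨τ, σ₁, h₁, φ₁, hI₁, hφ⟩ := hstep φ σ hI hb
      obtain ⟨τ', σ₂, h₂, φ₂, hI₂, hb₂, hφ₂⟩ := ih φ₁ (by omega) hI₁
      exact ⟨_, _, .loopStep hb h₁ h₂, φ₂, hI₂, hb₂, by omega⟩
    · exact ⟨_, _, .loopStop hb, φ, hI, hb, by omega⟩

end RAM

namespace Dinic

open RAM

theorem eval_add (e f : Expr Reg Arr) (σ : Store Reg Arr) :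
    (e + f).eval σ = e.eval σ + f.eval σ := rfl

theorem eval_sub (e f : Expr Reg Arr) (σ : Store Reg Arr) :
    (e - f).eval σ = e.eval σ - f.eval σ := rfl

theorem cost_sub (e f : Expr Reg Arr) : (e - f).cost = 1 + e.cost + f.cost := rfl

/-- Invariant rule for counting loops whose body takes at most `c` units of time. The bound `e` of
the loop has the constant value `N`. A round costs `3 + e.cost` for the test and `4` for the
increment of the counter. -/
theorem terminates_forLoop {k N c : ℕ} {e : Expr Reg Arr} {p : Prog Reg Arr} {σ : Store Reg Arr}
    (I : ℕ → Store Reg Arr → Prop) (hk : k ≤ N)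
    (hN : ∀ j σ, I j σ → e.eval σ = N) (hi : ∀ j σ, I j σ → σ.reg .i = j)
    (hstep : ∀ j σ, k ≤ j → j < N → I j σ →
      Terminates p (fun τ σ' => τ ≤ c ∧ I (j + 1) (σ'.setReg .i (σ'.reg .i + 1))) σ)
    (h₀ : I k (σ.setReg .i k)) :
    Terminates (forLoop k e p)
      (fun τ σ' => τ ≤ (N - k) * (c + 7 + e.cost) + (5 + e.cost) ∧ I N σ') σ := by
  unfold forLoop
  rw [terminates_seq, terminates_assign]
  have := terminates_loop (b := .lt (.var .i) e) (p := .seq p (.assign .i (.var .i + 1)))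
    (fun φ σ => ∃ j, k ≤ j ∧ j ≤ N ∧ I j σ ∧ φ = (N - j) * (c + 7 + e.cost))
    (by
      rintro φ σ ⟨j, hkj, hjN, hI, rfl⟩ hb
      have hlt : j < N := by
        have : σ.reg .i < e.eval σ := hb
        rwa [hi _ _ hI, hN _ _ hI] at this
      rw [terminates_seq]
      refine (hstep j σ hkj hlt hI).mono ?_
      rintro τ σ' ⟨hτ, hI'⟩
      rw [terminates_assign]
      refine ⟨_, ⟨j + 1, by omega, by omega, hI', rfl⟩, ?_⟩
      have : N - j = (N - (j + 1)) + 1 := by omega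
      rw [this, add_mul]
      simp only [Cond.cost, Expr.cost]
      have : (1 : Expr Reg Arr).cost = 1 := rfl
      omega)
    ⟨k, le_rfl, hk, h₀, rfl⟩
  refine this.mono ?_
  rintro τ σ' ⟨φ', ⟨j, hkj, hjN, hI, rfl⟩, hb, hτ⟩
  have : j = N := by
    have : ¬ σ'.reg .i < e.eval σ' := hb
    rw [hi _ _ hI, hN _ _ hI] at this
    omega
  subst this
  simp only [Cond.cost, Expr.cost] at hτ ⊢
  exact ⟨by omega, hI⟩

end Dinic

/-! ### Residual networks of unit-capacity networks -/

namespace Dinic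

/-- A unit-capacity network whose vertices are the numbers below `n` and whose edges are the numbers
below `m`; the edge `i` leads from `tail i` to `head i`. Edges into the
source or out of the sink are not excluded. -/
structure NumNet where
  n : ℕ
  m : ℕ
  s : ℕ
  t : ℕ
  tail : ℕ → ℕ
  head : ℕ → ℕ
  tail_lt : ∀ i < m, tail i < n
  head_lt : ∀ i < m, head i < n
  s_lt : s < n
  t_lt : t < n
  s_ne_t : s ≠ t

namespace NumNet

variable (G : NumNet)

/-- The start of a residual arc: the arc `i < m` is the edge `i`, the arc `i + m` its reverse. -/
def tl (a : ℕ) : ℕ := if a < G.m then G.tail a else G.head (a - G.m)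

/-- The end of a residual arc. -/
def hd (a : ℕ) : ℕ := if a < G.m then G.head a else G.tail (a - G.m)

/-- The reverse of a residual arc. -/
def rev (a : ℕ) : ℕ := if a < G.m then a + G.m else a - G.m

variable {G}

theorem tl_of_lt {i : ℕ} (h : i < G.m) : G.tl i = G.tail i := by simp [tl, h]
theorem hd_of_lt {i : ℕ} (h : i < G.m) : G.hd i = G.head i := by simp [hd, h]
theorem rev_of_lt {i : ℕ} (h : i < G.m) : G.rev i = i + G.m := by simp [rev, h]
theorem tl_add (i : ℕ) : G.tl (i + G.m) = G.head i := by simp [tl]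
theorem hd_add (i : ℕ) : G.hd (i + G.m) = G.tail i := by simp [hd]
theorem rev_add (i : ℕ) : G.rev (i + G.m) = i := by simp [rev]

theorem arc_cases {a : ℕ} (h : a < 2 * G.m) :
    a < G.m ∨ ∃ i < G.m, a = i + G.m := by
  by_cases h' : a < G.m
  · exact .inl h'
  · exact .inr ⟨a - G.m, by omega, by omega⟩

theorem tl_lt {a : ℕ} (h : a < 2 * G.m) : G.tl a < G.n := by
  obtain h | ⟨i, hi, rfl⟩ := arc_cases h
  · rw [tl_of_lt h]; exact G.tail_lt _ h
  · rw [tl_add]; exact G.head_lt _ hi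

theorem hd_lt {a : ℕ} (h : a < 2 * G.m) : G.hd a < G.n := by
  obtain h | ⟨i, hi, rfl⟩ := arc_cases h
  · rw [hd_of_lt h]; exact G.head_lt _ h
  · rw [hd_add]; exact G.tail_lt _ hi

theorem rev_lt {a : ℕ} (h : a < 2 * G.m) : G.rev a < 2 * G.m := by
  unfold rev; split <;> omega

theorem rev_rev {a : ℕ} (h : a < 2 * G.m) : G.rev (G.rev a) = a := by
  obtain h | ⟨i, hi, rfl⟩ := arc_cases h
  · rw [rev_of_lt h, rev_add]
  · rw [rev_add, rev_of_lt hi]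

theorem rev_ne {a : ℕ} (h : a < 2 * G.m) : G.rev a ≠ a := by
  unfold rev; split <;> omega

theorem tl_rev {a : ℕ} (h : a < 2 * G.m) : G.tl (G.rev a) = G.hd a := by
  obtain h | ⟨i, hi, rfl⟩ := arc_cases h
  · rw [rev_of_lt h, tl_add, hd_of_lt h]
  · rw [rev_add, tl_of_lt hi, hd_add]

theorem hd_rev {a : ℕ} (h : a < 2 * G.m) : G.hd (G.rev a) = G.tl a := by
  obtain h | ⟨i, hi, rfl⟩ := arc_cases h
  · rw [rev_of_lt h, hd_add, tl_of_lt h]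
  · rw [rev_add, hd_of_lt hi, tl_add]

variable (G)

/-- The net flow out of a vertex, for an assignment `g` of numbers to the edges. -/
def excess (g : ℕ → ℝ) (w : ℕ) : ℝ :=
  ∑ i ∈ Finset.range G.m,
    g i * ((if G.tail i = w then 1 else 0) - (if G.head i = w then 1 else 0))

/-- Feasible flows. -/
structure IsFlow (g : ℕ → ℝ) : Prop where
  nonneg : ∀ i < G.m, 0 ≤ g i
  le_one : ∀ i < G.m, g i ≤ 1
  conserved : ∀ w, w ≠ G.s → w ≠ G.t → G.excess g w = 0

/-- The flow that belongs to residual capacities: the flow on an edge is the residual capacity of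
the reverse arc. -/
def flowOf (res : ℕ → ℕ) (i : ℕ) : ℝ := res (i + G.m)

/-- Residual capacities of a flow with values `0` and `1`. -/
structure IsResidual (res : ℕ → ℕ) : Prop where
  pair : ∀ i < G.m, res i + res (i + G.m) = 1
  conserved : ∀ w, w ≠ G.s → w ≠ G.t → G.excess (G.flowOf res) w = 0

/-- The value of the flow that belongs to residual capacities: the net flow out of the source. -/
def value (res : ℕ → ℕ) : ℝ := G.excess (G.flowOf res) G.s

/-- Every inner vertex has in-degree one or out-degree one. -/
def IsType2 : Prop :=
  ∀ w < G.n, w ≠ G.s → w ≠ G.t →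
    ((Finset.range G.m).filter fun i => G.head i = w).card = 1 ∨
    ((Finset.range G.m).filter fun i => G.tail i = w).card = 1

variable {G}

theorem IsResidual.isFlow {res : ℕ → ℕ} (h : G.IsResidual res) : G.IsFlow (G.flowOf res) where
  nonneg i _ := by simp [flowOf]
  le_one i hi := by
    have := h.pair i hi
    have h' : res (i + G.m) ≤ 1 := by omega
    unfold flowOf
    exact_mod_cast h'
  conserved := h.conserved

theorem IsResidual.add_rev {res : ℕ → ℕ} (h : ∀ i < G.m, res i + res (i + G.m) = 1) {a : ℕ}
    (ha : a < 2 * G.m) : res a + res (G.rev a) = 1 := by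
  obtain ha | ⟨i, hi, rfl⟩ := arc_cases ha
  · rw [rev_of_lt ha]; exact h _ ha
  · rw [rev_add, add_comm]; exact h _ hi

theorem excess_eq_cut {g : ℕ → ℝ} (hg : ∀ w, w ≠ G.s → w ≠ G.t → G.excess g w = 0)
    {X : Finset ℕ} (hs : G.s ∈ X) (ht : G.t ∉ X) :
    G.excess g G.s = ∑ i ∈ Finset.range G.m,
      g i * ((if G.tail i ∈ X then 1 else 0) - (if G.head i ∈ X then 1 else 0)) := by
  have h₁ : ∑ w ∈ X, G.excess g w = G.excess g G.s :=
    Finset.sum_eq_single_of_mem _ hs fun w hw hne => hg w hne fun h => ht (h ▸ hw)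
  rw [← h₁]
  unfold excess
  rw [Finset.sum_comm]
  refine Finset.sum_congr rfl fun i _ => ?_
  rw [← Finset.mul_sum, Finset.sum_sub_distrib, Finset.sum_ite_eq, Finset.sum_ite_eq]

theorem sum_arcs (F : ℕ → ℝ) :
    ∑ a ∈ Finset.range (2 * G.m), F a = ∑ i ∈ Finset.range G.m, (F i + F (i + G.m)) := by
  rw [two_mul, Finset.sum_range_add, Finset.sum_add_distrib]
  simp only [add_comm]

/-- Weak duality in the residual network: the value of any flow exceeds that of the present flow by
at most the residual capacity of a cut. -/
theorem IsResidual.value_le_add_cut {res : ℕ → ℕ} (h : G.IsResidual res) {g : ℕ → ℝ}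
    (hg : G.IsFlow g) {X : Finset ℕ} (hs : G.s ∈ X) (ht : G.t ∉ X) :
    G.excess g G.s ≤ G.value res +
      ∑ a ∈ Finset.range (2 * G.m), if G.tl a ∈ X ∧ G.hd a ∉ X then (res a : ℝ) else 0 := by
  unfold value
  rw [excess_eq_cut hg.conserved hs ht, excess_eq_cut h.conserved hs ht, sum_arcs,
    ← Finset.sum_add_distrib]
  refine Finset.sum_le_sum fun i hi => ?_
  have hi := Finset.mem_range.1 hi
  have h₀ := hg.nonneg i hi
  have h₁ := hg.le_one i hi
  have h₂ : (res i : ℝ) + res (i + G.m) = 1 := by exact_mod_cast h.pair i hi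
  have h₃ : (0 : ℝ) ≤ res i := by positivity
  have h₄ : (0 : ℝ) ≤ res (i + G.m) := by positivity
  rw [tl_of_lt hi, hd_of_lt hi, tl_add, hd_add]
  unfold flowOf
  by_cases ha : G.tail i ∈ X <;> by_cases hb : G.head i ∈ X <;> simp [ha, hb] <;> linarith

/-- A flow leaves the residual in-degree of an inner vertex unchanged. -/
theorem IsResidual.sum_hd {res : ℕ → ℕ} (h : G.IsResidual res) {w : ℕ} (hs : w ≠ G.s)
    (ht : w ≠ G.t) :
    (∑ a ∈ Finset.range (2 * G.m), if G.hd a = w then (res a : ℝ) else 0) =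
      ((Finset.range G.m).filter fun i => G.head i = w).card := by
  suffices h₁ : (∑ a ∈ Finset.range (2 * G.m), if G.hd a = w then (res a : ℝ) else 0) =
      ((Finset.range G.m).filter fun i => G.head i = w).card + G.excess (G.flowOf res) w by
    rwa [h.conserved w hs ht, add_zero] at h₁
  rw [Finset.card_filter, Nat.cast_sum, sum_arcs]
  unfold excess
  rw [← Finset.sum_add_distrib]
  refine Finset.sum_congr rfl fun i hi => ?_
  have hi := Finset.mem_range.1 hi
  have h₂ : (res i : ℝ) + res (i + G.m) = 1 := by exact_mod_cast h.pair i hi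
  rw [hd_of_lt hi, hd_add, flowOf]
  split_ifs <;> simp <;> linarith

/-- A flow leaves the residual out-degree of an inner vertex unchanged. -/
theorem IsResidual.sum_tl {res : ℕ → ℕ} (h : G.IsResidual res) {w : ℕ} (hs : w ≠ G.s)
    (ht : w ≠ G.t) :
    (∑ a ∈ Finset.range (2 * G.m), if G.tl a = w then (res a : ℝ) else 0) =
      ((Finset.range G.m).filter fun i => G.tail i = w).card := by
  suffices h₁ : (∑ a ∈ Finset.range (2 * G.m), if G.tl a = w then (res a : ℝ) else 0) =
      ((Finset.range G.m).filter fun i => G.tail i = w).card - G.excess (G.flowOf res) w by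
    rwa [h.conserved w hs ht, sub_zero] at h₁
  rw [Finset.card_filter, Nat.cast_sum, sum_arcs]
  unfold excess
  rw [← Finset.sum_sub_distrib]
  refine Finset.sum_congr rfl fun i hi => ?_
  have hi := Finset.mem_range.1 hi
  have h₂ : (res i : ℝ) + res (i + G.m) = 1 := by exact_mod_cast h.pair i hi
  rw [tl_of_lt hi, tl_add, flowOf]
  split_ifs <;> simp <;> linarith

/-! ### Levels -/

variable (G)

/-- The vertex `v` has level `d + 1` if its distance from the source along arcs of positive residual
capacity is `d`, and level `0` if it is unreachable. -/
structure IsLevel (res lev : ℕ → ℕ) : Prop where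
  source : lev G.s = 1
  step : ∀ a < 2 * G.m, 0 < res a → lev (G.tl a) ≠ 0 →
    lev (G.hd a) ≠ 0 ∧ lev (G.hd a) ≤ lev (G.tl a) + 1
  pred : ∀ v < G.n, lev v ≠ 0 → v = G.s ∨
    ∃ a < 2 * G.m, 0 < res a ∧ G.hd a = v ∧ lev (G.tl a) ≠ 0 ∧ lev v = lev (G.tl a) + 1

variable {G}

/-- If the sink is unreachable in the residual network, the flow is maximum. -/
theorem IsLevel.optimal {res lev : ℕ → ℕ} (hl : G.IsLevel res lev) (h : G.IsResidual res)
    (ht : lev G.t = 0) {g : ℕ → ℝ} (hg : G.IsFlow g) : G.excess g G.s ≤ G.value res := by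
  have := h.value_le_add_cut hg (X := (Finset.range G.n).filter fun v => lev v ≠ 0)
    (by simp [G.s_lt, hl.source]) (by simp [ht])
  rwa [Finset.sum_eq_zero, add_zero] at this
  intro a ha
  have ha := Finset.mem_range.1 ha
  split_ifs with h'
  · simp only [Finset.mem_filter, Finset.mem_range, not_and, not_not] at h'
    by_contra h₀
    have := hl.step a ha (Nat.pos_of_ne_zero (by exact_mod_cast h₀)) h'.1.2
    exact this.1 (h'.2 (hd_lt ha))
  · rfl

/-- In a network of type 2 each level between the source and the sink is a bottleneck: the vertices
of the level, each of which has a single residual arc into it or out of it, bound the value that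
can still be gained. -/
theorem IsLevel.value_le_add_card {res lev : ℕ → ℕ} (hl : G.IsLevel res lev)
    (h : G.IsResidual res) (hG : G.IsType2) {i : ℕ} (hi : 2 ≤ i) (hit : i < lev G.t)
    {g : ℕ → ℝ} (hg : G.IsFlow g) :
    G.excess g G.s ≤
      G.value res + ((Finset.range G.n).filter fun v => lev v = i).card := by
  classical
  set L := (Finset.range G.n).filter fun v => lev v = i with hL
  -- The cut separates the vertices before the level, and those of its vertices that have a single
  -- arc out of them, from the rest. So each crossing arc is the single arc into or out of a vertex
  -- of the level.
  let out (w : ℕ) : Prop := ((Finset.range G.m).filter fun i => G.tail i = w).card = 1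
  have hcut := h.value_le_add_cut hg
    (X := (Finset.range G.n).filter fun v => lev v ≠ 0 ∧ (lev v < i ∨ lev v = i ∧ out v))
    (by
      simp only [Finset.mem_filter, Finset.mem_range, G.s_lt, hl.source]
      exact ⟨trivial, one_ne_zero, .inl (by omega)⟩)
    (by
      simp only [Finset.mem_filter, Finset.mem_range]
      rintro ⟨-, -, h | ⟨h, -⟩⟩ <;> omega)
  refine hcut.trans (add_le_add_right ?_ _)
  have hsum : ∀ w ∈ L, (∑ a ∈ Finset.range (2 * G.m),
      if (if out w then G.tl a else G.hd a) = w then (res a : ℝ) else 0) = 1 := by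
    intro w hw
    simp only [hL, Finset.mem_filter, Finset.mem_range] at hw
    have hs : w ≠ G.s := by rintro rfl; have := hl.source; omega
    have ht : w ≠ G.t := by rintro rfl; omega
    by_cases ho : out w
    · simp only [ho, if_true, h.sum_tl hs ht]
      exact_mod_cast ho
    · simp only [ho, if_false, h.sum_hd hs ht]
      exact_mod_cast (hG w hw.1 hs ht).resolve_right ho
  calc _ ≤ ∑ a ∈ Finset.range (2 * G.m), ∑ w ∈ L,
        (if (if out w then G.tl a else G.hd a) = w then (res a : ℝ) else 0) := by
        refine Finset.sum_le_sum fun a ha => ?_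
        have ha := Finset.mem_range.1 ha
        have hnn : ∀ w ∈ L,
            (0 : ℝ) ≤ if (if out w then G.tl a else G.hd a) = w then (res a : ℝ) else 0 := by
          intro w _; positivity
        split_ifs with hX
        · rcases Nat.eq_zero_or_pos (res a) with h₀ | h₀
          · simp [h₀]
          · simp only [Finset.mem_filter, Finset.mem_range, tl_lt ha, hd_lt ha, true_and] at hX
            obtain ⟨⟨h₁, h₂⟩, h₃⟩ := hX
            obtain ⟨h₄, h₅⟩ := hl.step a ha h₀ h₁
            rcases h₂ with h₂ | ⟨h₂, ho⟩
            · have hlev : lev (G.hd a) = i := by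
                by_contra hne
                exact h₃ ⟨h₄, .inl (by omega)⟩
              have ho : ¬ out (G.hd a) := fun ho => h₃ ⟨h₄, .inr ⟨hlev, ho⟩⟩
              have := Finset.single_le_sum hnn
                (show G.hd a ∈ L by simp [hL, hd_lt ha, hlev])
              simpa [ho] using this
            · have := Finset.single_le_sum hnn
                (show G.tl a ∈ L by simp [hL, tl_lt ha, h₂])
              simpa [ho] using this
        · exact Finset.sum_nonneg hnn
    _ = ∑ w ∈ L, 1 := by rw [Finset.sum_comm]; exact Finset.sum_congr rfl hsum
    _ = L.card := by simp

/-- If the sink has distance at least `k + 1` from the source, then the value can grow by at most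
`n / k`, because one of `k` disjoint levels has at most `n / k` vertices. -/
theorem IsLevel.value_le_add_div {res lev : ℕ → ℕ} (hl : G.IsLevel res lev)
    (h : G.IsResidual res) (hG : G.IsType2) {k : ℕ} (hk : 0 < k) (hkt : k + 2 ≤ lev G.t)
    {g : ℕ → ℝ} (hg : G.IsFlow g) : G.excess g G.s ≤ G.value res + (G.n / k : ℕ) := by
  obtain ⟨i, hi, hc⟩ : ∃ i ∈ Finset.Ico 2 (k + 2),
      ((Finset.range G.n).filter fun v => lev v = i).card ≤ G.n / k := by
    by_contra! hcon
    have h₁ := Finset.card_nsmul_le_sum _ _ (G.n / k + 1) (fun i hi => hcon i hi)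
    have h₂ : ∑ i ∈ Finset.Ico 2 (k + 2), ((Finset.range G.n).filter fun v => lev v = i).card
        ≤ G.n := by
      rw [← Finset.card_biUnion]
      · refine (Finset.card_le_card (t := Finset.range G.n) ?_).trans (by simp)
        intro v hv
        simp only [Finset.mem_biUnion, Finset.mem_filter] at hv
        obtain ⟨_, _, hv, _⟩ := hv
        exact hv
      · intro i _ j _ hij
        refine Finset.disjoint_left.2 fun v hv hv' => hij ?_
        rw [← (Finset.mem_filter.1 hv).2, (Finset.mem_filter.1 hv').2]
    have h₃ := Nat.lt_mul_div_succ G.n hk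
    simp only [Nat.card_Ico, smul_eq_mul, Nat.add_sub_cancel] at h₁
    omega
  have hi := Finset.mem_Ico.1 hi
  refine (hl.value_le_add_card h hG hi.1 (by omega) hg).trans ?_
  gcongr

variable (G)

/-- What a phase achieves: with respect to the old levels, new residual arcs lead one level back,
and no path of arcs that lead one level forward connects the source to the sink, as is witnessed by
the set of dead vertices. -/
structure IsBlocked (res lev res' : ℕ → ℕ) : Prop where
  old_or_back : ∀ a < 2 * G.m, 0 < res' a → 0 < res a ∨
    lev (G.hd a) ≠ 0 ∧ lev (G.tl a) = lev (G.hd a) + 1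
  dead : ∃ dead : ℕ → Prop, dead G.s ∧ ¬ dead G.t ∧
    ∀ a < 2 * G.m, 0 < res' a → dead (G.tl a) → lev (G.hd a) = lev (G.tl a) + 1 → dead (G.hd a)

variable {G}

/-- A phase moves the sink further away from the source. -/
theorem IsLevel.lt_of_isBlocked {res lev res' lev' : ℕ → ℕ} (hl : G.IsLevel res lev)
    (hl' : G.IsLevel res' lev') (hb : G.IsBlocked res lev res')
    (ht : lev' G.t ≠ 0) : lev G.t < lev' G.t := by
  obtain ⟨dead, hs, ht', hd⟩ := hb.dead
  -- New levels are at least the old ones, and equality forces a path in the old level graph, all of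
  -- whose vertices are dead.
  have key : ∀ k v, v < G.n → lev' v = k → k ≠ 0 →
      lev v ≠ 0 ∧ lev v ≤ k ∧ (lev v = k → dead v) := by
    intro k
    induction k using Nat.strong_induction_on with
    | _ k ih =>
      intro v hv hk h₀
      rcases hl'.pred v hv (hk ▸ h₀) with rfl | ⟨a, ha, hr, rfl, h₁, h₂⟩
      · rw [hl'.source] at hk
        rw [hl.source]
        exact ⟨one_ne_zero, by omega, fun _ => hs⟩
      · obtain ⟨h₃, h₄, h₅⟩ := ih _ (by omega) (G.tl a) (tl_lt ha) rfl h₁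
        rcases hb.old_or_back a ha hr with h₆ | ⟨h₆, h₇⟩
        · obtain ⟨h₈, h₉⟩ := hl.step a ha h₆ h₃
          exact ⟨h₈, by omega, fun h => hd a ha hr (h₅ (by omega)) (by omega)⟩
        · exact ⟨h₆, by omega, fun h => by omega⟩
  obtain ⟨_, h₁, h₂⟩ := key _ G.t G.t_lt rfl ht
  exact lt_of_le_of_ne h₁ fun h => ht' (h₂ h)

/-! ### Augmenting paths -/

variable (G)

/-- A walk `p` from the source to `v`, given by its arcs, each of which leads one level forward. -/
inductive LevelWalk (lev : ℕ → ℕ) : List ℕ → ℕ → Prop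
  | nil : LevelWalk lev [] G.s
  | snoc {p : List ℕ} {a : ℕ} : LevelWalk lev p (G.tl a) → a < 2 * G.m →
      lev (G.hd a) = lev (G.tl a) + 1 → LevelWalk lev (p ++ [a]) (G.hd a)

/-- Pushing one unit of flow along an arc. -/
def push (res : ℕ → ℕ) (a : ℕ) : ℕ → ℕ :=
  Function.update (Function.update res a (res a - 1)) (G.rev a) (res (G.rev a) + 1)

variable {G}

theorem LevelWalk.snoc_inv {lev : ℕ → ℕ} {p : List ℕ} {a v : ℕ}
    (h : G.LevelWalk lev (p ++ [a]) v) :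
    G.LevelWalk lev p (G.tl a) ∧ a < 2 * G.m ∧ lev (G.hd a) = lev (G.tl a) + 1 ∧
      v = G.hd a := by
  generalize hq : p ++ [a] = q at h
  cases h with
  | nil => simp at hq
  | snoc h₁ h₂ h₃ =>
    obtain ⟨rfl, h⟩ := List.append_inj' hq rfl
    simp only [List.cons.injEq, and_true] at h
    subst h
    exact ⟨h₁, h₂, h₃, rfl⟩

theorem LevelWalk.nil_inv {lev : ℕ → ℕ} {v : ℕ} (h : G.LevelWalk lev [] v) : v = G.s := by
  generalize hq : ([] : List ℕ) = q at h
  cases h with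
  | nil => rfl
  | snoc => simp at hq

theorem LevelWalk.mem {lev : ℕ → ℕ} {p : List ℕ} {v : ℕ} (h : G.LevelWalk lev p v) :
    ∀ a ∈ p, a < 2 * G.m ∧ lev (G.hd a) = lev (G.tl a) + 1 ∧ lev (G.tl a) < lev v := by
  induction h with
  | nil => simp
  | @snoc p b h₁ h₂ h₃ ih =>
    intro a ha
    rcases List.mem_append.1 ha with ha | ha
    · obtain ⟨h₄, h₅, h₆⟩ := ih a ha
      exact ⟨h₄, h₅, by omega⟩
    · obtain rfl := List.mem_singleton.1 ha
      exact ⟨h₂, h₃, by omega⟩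

theorem LevelWalk.nodup {lev : ℕ → ℕ} {p : List ℕ} {v : ℕ} (h : G.LevelWalk lev p v) :
    p.Nodup := by
  induction h with
  | nil => simp
  | @snoc p b h₁ h₂ h₃ ih =>
    rw [← List.concat_eq_append]
    refine ih.concat fun hb => ?_
    exact lt_irrefl _ (h₁.mem b hb).2.2

theorem LevelWalk.lt {lev : ℕ → ℕ} {p : List ℕ} {v : ℕ} (h : G.LevelWalk lev p v) : v < G.n := by
  cases h with
  | nil => exact G.s_lt
  | snoc _ h₂ _ => exact hd_lt h₂

theorem push_self {res : ℕ → ℕ} {a : ℕ} (ha : a < 2 * G.m) : G.push res a a = res a - 1 := by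
  unfold push
  rw [Function.update_of_ne (rev_ne ha).symm, Function.update_self]

theorem push_rev {res : ℕ → ℕ} {a : ℕ} : G.push res a (G.rev a) = res (G.rev a) + 1 := by
  unfold push
  rw [Function.update_self]

theorem push_of_ne {res : ℕ → ℕ} {a x : ℕ} (h₁ : x ≠ a) (h₂ : x ≠ G.rev a) :
    G.push res a x = res x := by
  unfold push
  rw [Function.update_of_ne h₂, Function.update_of_ne h₁]

theorem excess_push {res : ℕ → ℕ} {a : ℕ} (ha : a < 2 * G.m) (h : res a = 1) (w : ℕ) :
    G.excess (G.flowOf (G.push res a)) w = G.excess (G.flowOf res) w +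
      ((if G.tl a = w then 1 else 0) - if G.hd a = w then 1 else 0) := by
  rw [← sub_eq_iff_eq_add']
  unfold excess
  rw [← Finset.sum_sub_distrib]
  obtain hi | ⟨i, hi, rfl⟩ := arc_cases ha
  · rw [Finset.sum_eq_single_of_mem a (Finset.mem_range.2 hi)]
    · have : G.flowOf (G.push res a) a = G.flowOf res a + 1 := by
        unfold flowOf
        rw [← rev_of_lt hi, push_rev]
        push_cast
        rfl
      rw [this, tl_of_lt hi, hd_of_lt hi]
      ring
    · intro j hj hne
      have hj := Finset.mem_range.1 hj
      have : G.flowOf (G.push res a) j = G.flowOf res j := by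
        unfold flowOf
        rw [push_of_ne (by omega) (by rw [rev_of_lt hi]; omega)]
      rw [this, sub_self]
  · rw [Finset.sum_eq_single_of_mem i (Finset.mem_range.2 hi)]
    · have : G.flowOf (G.push res (i + G.m)) i = G.flowOf res i - 1 := by
        unfold flowOf
        rw [push_self ha, h]
        simp
      rw [this, tl_add, hd_add]
      ring
    · intro j hj hne
      have hj := Finset.mem_range.1 hj
      have : G.flowOf (G.push res (i + G.m)) j = G.flowOf res j := by
        unfold flowOf
        rw [push_of_ne (by omega) (by rw [rev_add]; omega)]
      rw [this, sub_self]

/-- The effect of pushing one unit of flow along a walk in the level graph. -/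
theorem LevelWalk.foldl_push {lev res : ℕ → ℕ} {p : List ℕ} {v : ℕ} (h : G.LevelWalk lev p v)
    (hpair : ∀ i < G.m, res i + res (i + G.m) = 1) (hp : ∀ a ∈ p, res a = 1) :
    (∀ i < G.m, p.foldl G.push res i + p.foldl G.push res (i + G.m) = 1) ∧
    (∀ a ∈ p, p.foldl G.push res a = 0) ∧
    (∀ x < 2 * G.m, x ∉ p → G.rev x ∉ p → p.foldl G.push res x = res x) ∧
    ∀ w, G.excess (G.flowOf (p.foldl G.push res)) w = G.excess (G.flowOf res) w +
      ((if G.s = w then 1 else 0) - if v = w then 1 else 0) := by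
  induction h with
  | nil => simpa using hpair
  | @snoc p a h₁ h₂ h₃ ih =>
    obtain ⟨i₁, i₂, i₃, i₄⟩ := ih fun b hb => hp b (by simp [hb])
    have ha : a ∉ p := fun hb => lt_irrefl _ (h₁.mem a hb).2.2
    have hra : G.rev a ∉ p := fun hb => by
      have := (h₁.mem _ hb).2
      rw [hd_rev h₂, tl_rev h₂] at this
      omega
    have hr : p.foldl G.push res a = 1 := by rw [i₃ a h₂ ha hra]; exact hp a (by simp)
    simp only [List.foldl_append, List.foldl_cons, List.foldl_nil]
    set r := p.foldl G.push res with hrdef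
    have hr' : r (G.rev a) = 0 := by
      have := IsResidual.add_rev i₁ h₂
      omega
    refine ⟨?_, ?_, ?_, ?_⟩
    · intro i hi
      by_cases h₄ : i = a
      · subst h₄
        rw [push_self h₂, ← rev_of_lt hi, push_rev, hr, hr']
      · by_cases h₅ : i = G.rev a
        · have h₆ : i + G.m = a := by rw [← rev_of_lt hi, h₅, rev_rev h₂]
          rw [h₆, push_self h₂, h₅, push_rev, hr, hr']
        · rw [push_of_ne h₄ h₅, push_of_ne, i₁ i hi]
          · intro h₆; apply h₅; rw [← h₆, rev_add]
          · intro h₆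
            apply h₄
            rw [← rev_rev h₂, ← h₆, rev_add]
    · intro b hb
      rcases List.mem_append.1 hb with hb | hb
      · rw [push_of_ne (ne_of_mem_of_not_mem hb ha) (ne_of_mem_of_not_mem hb hra), i₂ b hb]
      · obtain rfl := List.mem_singleton.1 hb
        rw [push_self h₂, hr]
    · intro x hx h₄ h₅
      simp only [List.mem_append, List.mem_singleton, not_or] at h₄ h₅
      rw [push_of_ne h₄.2 (fun h => h₅.2 (by rw [h, rev_rev h₂])), i₃ x hx h₄.1 h₅.1]
    · intro w
      rw [excess_push h₂ hr, i₄ w]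
      ring

end NumNet
end Dinic

/-! ### Adjacency lists -/

namespace Dinic

open RAM

/-- The pointer `p` and the links `nxt` represent the list `l`. -/
def IsList (nxt : ℕ → ℕ) : ℕ → List ℕ → Prop
  | p, [] => p = 0
  | p, a :: l => p = a + 1 ∧ IsList nxt (nxt a) l

theorem IsList.update {nxt : ℕ → ℕ} {p x k : ℕ} {l : List ℕ} (h : IsList nxt p l)
    (hx : x ∉ l) : IsList (Function.update nxt x k) p l := by
  induction l generalizing p with
  | nil => exact h
  | cons a l ih =>
    simp only [List.mem_cons, not_or] at hx
    refine ⟨h.1, ?_⟩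
    rw [Function.update_of_ne (Ne.symm hx.1)]
    exact ih h.2 hx.2

theorem IsList.eq_zero_iff {nxt : ℕ → ℕ} {p : ℕ} {l : List ℕ} (h : IsList nxt p l) :
    p = 0 ↔ l = [] := by
  cases l with
  | nil => simpa [IsList] using h
  | cons a l => simp [h.1]

theorem IsList.exists_cons {nxt : ℕ → ℕ} {p : ℕ} {l : List ℕ} (h : IsList nxt p l)
    (hp : p ≠ 0) : ∃ a l', l = a :: l' ∧ p = a + 1 ∧ IsList nxt (nxt a) l' := by
  cases l with
  | nil => exact absurd h hp
  | cons a l => exact ⟨a, l, rfl, h⟩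

/-- Prepending an element to one of several lists that share their links. -/
theorem IsList.prepend {nxt first : ℕ → ℕ} {L : ℕ → List ℕ} {n x : ℕ}
    (h : ∀ u < n, IsList nxt (first u) (L u)) (v : ℕ) (hx : ∀ u, x ∉ L u) :
    ∀ u < n, IsList (Function.update nxt x (first v)) (Function.update first v (x + 1) u)
      ((if v = u then [x] else []) ++ L u) := by
  intro u hu
  by_cases huv : v = u
  · subst huv
    rw [if_pos rfl, Function.update_self]
    refine ⟨rfl, ?_⟩
    rw [Function.update_self]
    exact (h v hu).update (hx v)
  · rw [if_neg huv, Function.update_of_ne (Ne.symm huv)]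
    exact (h u hu).update (hx u)

namespace NumNet

variable (G : NumNet)

/-- The residual arcs of the first `j` edges that leave `u`, in the order of the adjacency list. -/
def adjUpTo : ℕ → ℕ → List ℕ
  | 0, _ => []
  | j + 1, u =>
    (if G.head j = u then [j + G.m] else []) ++ ((if G.tail j = u then [j] else []) ++
      adjUpTo j u)

/-- The residual arcs that leave `u`. -/
def adj (u : ℕ) : List ℕ := G.adjUpTo G.m u

variable {G}

theorem mem_adjUpTo {j u a : ℕ} (hj : j ≤ G.m) :
    a ∈ G.adjUpTo j u ↔ G.tl a = u ∧ (a < j ∨ G.m ≤ a ∧ a < j + G.m) := by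
  induction j with
  | zero => simp only [adjUpTo, List.not_mem_nil, false_iff]; omega
  | succ j ih =>
    simp only [adjUpTo, List.mem_append, ih (by omega)]
    by_cases h₁ : a = j
    · subst h₁
      have : G.tl a = G.tail a := tl_of_lt (by omega)
      have hm : G.m ≠ 0 := by omega
      split_ifs <;> simp_all
    · by_cases h₂ : a = j + G.m
      · subst h₂
        have : G.tl (j + G.m) = G.head j := tl_add j
        split_ifs <;> simp_all
      · have h₃ : (a < j + 1 ∨ G.m ≤ a ∧ a < j + 1 + G.m) ↔ (a < j ∨ G.m ≤ a ∧ a < j + G.m) := by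
          omega
        rw [h₃]
        split_ifs <;> simp [h₁, h₂]

theorem mem_adj {u a : ℕ} : a ∈ G.adj u ↔ G.tl a = u ∧ a < 2 * G.m := by
  rw [adj, mem_adjUpTo le_rfl]
  refine and_congr_right fun _ => ?_
  omega

theorem sum_length_adjUpTo {j : ℕ} (hj : j ≤ G.m) :
    ∑ u ∈ Finset.range G.n, (G.adjUpTo j u).length = 2 * j := by
  induction j with
  | zero => simp [adjUpTo]
  | succ j ih =>
    have h₁ := G.tail_lt j hj
    have h₂ := G.head_lt j hj
    simp only [adjUpTo, List.length_append, Finset.sum_add_distrib, ih (by omega),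
      apply_ite List.length, List.length_singleton, List.length_nil, Finset.sum_ite_eq,
      Finset.mem_range, h₁, h₂, if_true]
    omega

theorem sum_length_adj : ∑ u ∈ Finset.range G.n, (G.adj u).length = 2 * G.m :=
  sum_length_adjUpTo le_rfl

end NumNet

/-- The memory holds the part of the residual network that does not change: the size, source and
sink, and the adjacency lists of the residual arcs. -/
structure Static (G : NumNet) (σ : Store Reg Arr) : Prop where
  n : σ.reg .n = G.n
  m : σ.reg .m = G.m
  s : σ.reg .s = G.s
  t : σ.reg .t = G.t
  arcTo : ∀ a < 2 * G.m, σ.arr .to a = G.hd a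
  arcRev : ∀ a < 2 * G.m, σ.arr .rev a = G.rev a
  list : ∀ u < G.n, IsList (σ.arr .nxt) (σ.arr .first u) (G.adj u)

/-- `Static` depends only on a part of the memory. -/
theorem Static.congr {G : NumNet} {σ σ' : Store Reg Arr} (h : Static G σ)
    (hn : σ'.reg .n = σ.reg .n) (hm : σ'.reg .m = σ.reg .m) (hs : σ'.reg .s = σ.reg .s)
    (ht : σ'.reg .t = σ.reg .t) (hto : σ'.arr .to = σ.arr .to) (hrev : σ'.arr .rev = σ.arr .rev)
    (hnxt : σ'.arr .nxt = σ.arr .nxt) (hfirst : σ'.arr .first = σ.arr .first) : Static G σ' where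
  n := hn.trans h.n
  m := hm.trans h.m
  s := hs.trans h.s
  t := ht.trans h.t
  arcTo := by rw [hto]; exact h.arcTo
  arcRev := by rw [hrev]; exact h.arcRev
  list := by rw [hnxt, hfirst]; exact h.list

/-- What `build` has achieved after it has treated the first `j` edges. -/
structure BuildInv (G : NumNet) (j : ℕ) (σ : Store Reg Arr) : Prop where
  i : σ.reg .i = j
  n : σ.reg .n = G.n
  m : σ.reg .m = G.m
  s : σ.reg .s = G.s
  t : σ.reg .t = G.t
  tail : σ.arr .tail = G.tail
  head : σ.arr .head = G.head
  cap : ∀ i < G.m, σ.arr .cap i = 1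
  arcTo : ∀ i < j, σ.arr .to i = G.head i ∧ σ.arr .to (i + G.m) = G.tail i
  arcRev : ∀ i < j, σ.arr .rev i = i + G.m ∧ σ.arr .rev (i + G.m) = i
  res : ∀ i < j, σ.arr .res i = 1 ∧ σ.arr .res (i + G.m) = 0
  list : ∀ u < G.n, IsList (σ.arr .nxt) (σ.arr .first u) (G.adjUpTo j u)

theorem terminates_build {G : NumNet} {σ : Store Reg Arr}
    (n : σ.reg .n = G.n) (m : σ.reg .m = G.m) (s : σ.reg .s = G.s) (t : σ.reg .t = G.t)
    (tail : σ.arr .tail = G.tail) (head : σ.arr .head = G.head)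
    (cap : ∀ i < G.m, σ.arr .cap i = 1) :
    Terminates build (fun τ σ' => τ ≤ 100 * (G.n + G.m + 1) ∧ Static G σ' ∧
      ∀ i < G.m, σ'.arr .res i = 1 ∧ σ'.arr .res (i + G.m) = 0) σ := by
  unfold build
  rw [terminates_seq]
  refine (terminates_forLoop (N := G.n) (c := 4) (e := .var .n) (fun j σ => σ.reg .i = j ∧
    σ.reg .n = G.n ∧ σ.reg .m = G.m ∧ σ.reg .s = G.s ∧ σ.reg .t = G.t ∧ σ.arr .tail = G.tail ∧
    σ.arr .head = G.head ∧ (∀ i < G.m, σ.arr .cap i = 1) ∧ ∀ u < j, σ.arr .first u = 0)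
    (Nat.zero_le _) (fun j σ h => h.2.1) (fun j σ h => h.1) ?_ ?_).mono ?_
  · rintro j σ - hj ⟨h₁, h₂, h₃, h₄, h₅, h₆, h₇, h₈, h₉⟩
    simp only [terminates_write, Store.setReg_reg, Store.setReg_arr, Store.setCell_reg,
      Store.setCell_arr, Expr.eval, Expr.cost, reduceCtorEq, if_true,
      if_false, h₁, h₂, h₃, h₄, h₅, h₆, h₇]
    refine ⟨by norm_num, trivial, trivial, trivial, trivial, trivial, trivial, trivial, h₈, ?_⟩
    intro u hu
    by_cases h : u = j
    · rw [h, Function.update_self]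
    · rw [Function.update_of_ne h]; exact h₉ u (by omega)
  · simp only [Store.setReg_reg, Store.setReg_arr, reduceCtorEq, if_true, if_false, n, m, s, t,
      tail, head]
    exact ⟨trivial, trivial, trivial, trivial, trivial, trivial, trivial, cap, by simp⟩
  · rintro τ σ₁ ⟨hτ, h₁, h₂, h₃, h₄, h₅, h₆, h₇, h₈, h₉⟩
    refine (terminates_forLoop (N := G.m) (c := 60) (e := .var .m) (BuildInv G)
      (Nat.zero_le _) (fun j σ h => h.m) (fun j σ h => h.i) ?_ ?_).mono ?_
    · rintro j σ - hj h
      simp only [terminates_seq, terminates_write, Store.setCell_reg, Store.setCell_arr,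
        Expr.eval, Expr.cost, eval_add, reduceCtorEq, if_true, if_false, h.i, h.m, h.tail, h.head]
      refine ⟨by norm_num, ?_⟩
      have hu₁ : ∀ (f : ℕ → ℕ) x y i, i < j →
          Function.update (Function.update f j x) (j + G.m) y i = f i := by
        intro f x y i hi
        rw [Function.update_of_ne (by omega), Function.update_of_ne (by omega)]
      have hu₂ : ∀ (f : ℕ → ℕ) x y i, i < j →
          Function.update (Function.update f j x) (j + G.m) y (i + G.m) = f (i + G.m) := by
        intro f x y i hi
        rw [Function.update_of_ne (by omega), Function.update_of_ne (by omega)]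
      have hu₃ : ∀ (f : ℕ → ℕ) x y,
          Function.update (Function.update f j x) (j + G.m) y j = x := by
        intro f x y
        rw [Function.update_of_ne (by omega), Function.update_self]
      have hu₄ : ∀ (f : ℕ → ℕ) x y,
          Function.update (Function.update f j x) (j + G.m) y (j + G.m) = y := by
        intro f x y
        rw [Function.update_self]
      constructor <;>
        simp only [Store.setReg_reg, Store.setReg_arr, Store.setCell_reg, Store.setCell_arr,
          reduceCtorEq, if_true, if_false, h.i, h.n, h.m, h.s, h.t, h.tail, h.head]
      · exact h.cap
      · intro i hi
        rcases Nat.lt_succ_iff_lt_or_eq.1 hi with hi | rfl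
        · rw [hu₁ _ _ _ _ hi, hu₂ _ _ _ _ hi]; exact h.arcTo i hi
        · rw [hu₃, hu₄]; exact ⟨rfl, rfl⟩
      · intro i hi
        rcases Nat.lt_succ_iff_lt_or_eq.1 hi with hi | rfl
        · rw [hu₁ _ _ _ _ hi, hu₂ _ _ _ _ hi]; exact h.arcRev i hi
        · rw [hu₃, hu₄]; exact ⟨rfl, rfl⟩
      · intro i hi
        rcases Nat.lt_succ_iff_lt_or_eq.1 hi with hi | rfl
        · rw [hu₁ _ _ _ _ hi, hu₂ _ _ _ _ hi]; exact h.res i hi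
        · rw [hu₃, hu₄]; exact ⟨h.cap _ hj, rfl⟩
      · have hmem : ∀ u, j ∉ G.adjUpTo j u ∧ j + G.m ∉ G.adjUpTo j u := by
          intro u
          rw [NumNet.mem_adjUpTo hj.le, NumNet.mem_adjUpTo hj.le]
          omega
        have h₁ := IsList.prepend h.list (G.tail j) fun u => (hmem u).1
        refine IsList.prepend h₁ (G.head j) fun u => ?_
        have hm : G.m ≠ 0 := by omega
        split_ifs <;> simp [hm, (hmem u).2]
    · constructor <;>
        simp only [Store.setReg_reg, Store.setReg_arr, reduceCtorEq, if_true, if_false, h₂, h₃, h₄,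
          h₅, h₆, h₇]
      · exact h₈
      · simp
      · simp
      · simp
      · exact h₉
    · rintro τ' σ₂ ⟨hτ', h⟩
      refine ⟨?_, ⟨h.n, h.m, h.s, h.t, ?_, ?_, h.list⟩, h.res⟩
      · simp only [Expr.cost] at hτ hτ'
        omega
      · intro a ha
        obtain h' | ⟨i, hi, rfl⟩ := NumNet.arc_cases ha
        · rw [NumNet.hd_of_lt h']; exact (h.arcTo a h').1
        · rw [NumNet.hd_add]; exact (h.arcTo i hi).2
      · intro a ha
        obtain h' | ⟨i, hi, rfl⟩ := NumNet.arc_cases ha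
        · rw [NumNet.rev_of_lt h']; exact (h.arcRev a h').1
        · rw [NumNet.rev_add]; exact (h.arcRev i hi).2

end Dinic

/-! ### Breadth-first search -/

namespace Dinic

open RAM

/-- The invariant of breadth-first search. Here `pend` is the waiting part of the queue, and
`scanned v a` says that, if `v` has been taken from the queue, its arc `a` has been treated. -/
structure Frontier (G : NumNet) (res lev : ℕ → ℕ) (pend : List ℕ) (scanned : ℕ → ℕ → Prop) :
    Prop where
  mem : ∀ v ∈ pend, v < G.n ∧ lev v ≠ 0
  sorted : pend.Pairwise fun v w => lev v ≤ lev w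
  source : lev G.s = 1
  pred : ∀ v < G.n, lev v ≠ 0 → v = G.s ∨
    ∃ a < 2 * G.m, 0 < res a ∧ G.hd a = v ∧ lev (G.tl a) ≠ 0 ∧ lev v = lev (G.tl a) + 1
  explored : ∀ v < G.n, lev v ≠ 0 → v ∉ pend → ∀ a ∈ G.adj v, scanned v a → 0 < res a →
    lev (G.hd a) ≠ 0 ∧ lev (G.hd a) ≤ lev v + 1

/-- An arc of `u` that leads to a labelled vertex or has no residual capacity is passed over. -/
theorem Frontier.skip {G : NumNet} {res lev : ℕ → ℕ} {pend rem : List ℕ} {u a : ℕ}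
    (h : Frontier G res lev pend fun v b => v = u → b ∉ a :: rem)
    (hmax : ∀ v < G.n, lev v ≤ lev u + 1) (ha : a < 2 * G.m)
    (h₀ : 0 < res a → lev (G.hd a) ≠ 0) :
    Frontier G res lev pend fun v b => v = u → b ∉ rem where
  mem := h.mem
  sorted := h.sorted
  source := h.source
  pred := h.pred
  explored v hv hlv hvp b hb hs hr := by
    by_cases hba : v = u ∧ b = a
    · obtain ⟨rfl, rfl⟩ := hba
      exact ⟨h₀ hr, hmax _ (NumNet.hd_lt ha)⟩
    · refine h.explored v hv hlv hvp b hb (fun hvu => ?_) hr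
      rw [List.mem_cons, not_or]
      exact ⟨fun h => hba ⟨hvu, h⟩, hs hvu⟩

/-- The end of an arc of `u` receives a label and joins the queue. -/
theorem Frontier.label {G : NumNet} {res lev : ℕ → ℕ} {pend rem : List ℕ} {u a : ℕ}
    (h : Frontier G res lev pend fun v b => v = u → b ∉ a :: rem)
    (hmax : ∀ v < G.n, lev v ≤ lev u + 1) (ha : a < 2 * G.m) (htl : G.tl a = u) (hlu : lev u ≠ 0)
    (hr : 0 < res a) (h₀ : lev (G.hd a) = 0) :
    Frontier G res (Function.update lev (G.hd a) (lev u + 1)) (pend ++ [G.hd a])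
      fun v b => v = u → b ∉ rem := by
  have hupd : ∀ v, lev v ≠ 0 → Function.update lev (G.hd a) (lev u + 1) v = lev v := by
    intro v hv
    rw [Function.update_of_ne]
    rintro rfl
    exact hv h₀
  have hself : Function.update lev (G.hd a) (lev u + 1) (G.hd a) = lev u + 1 :=
    Function.update_self ..
  constructor
  · intro v hv
    rcases List.mem_append.1 hv with hv | hv
    · rw [hupd v (h.mem v hv).2]; exact h.mem v hv
    · rw [List.mem_singleton.1 hv, hself]
      exact ⟨NumNet.hd_lt ha, by omega⟩
  · refine List.pairwise_append.2 ⟨h.sorted.imp_of_mem ?_, List.pairwise_singleton _ _, ?_⟩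
    · intro v w hv hw hvw
      rwa [hupd v (h.mem v hv).2, hupd w (h.mem w hw).2]
    · intro v hv w hw
      rw [List.mem_singleton.1 hw, hself, hupd v (h.mem v hv).2]
      exact hmax v (h.mem v hv).1
  · rw [hupd _ (by rw [h.source]; exact one_ne_zero), h.source]
  · intro v hv hlv
    by_cases hva : v = G.hd a
    · subst hva
      refine .inr ⟨a, ha, hr, rfl, ?_⟩
      rw [htl, hself, hupd u hlu]
      exact ⟨hlu, rfl⟩
    · rw [Function.update_of_ne hva] at hlv ⊢
      rcases h.pred v hv hlv with h | ⟨b, hb, hr, hh, h₁, h₂⟩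
      · exact .inl h
      · exact .inr ⟨b, hb, hr, hh, by rw [hupd _ h₁]; exact ⟨h₁, h₂⟩⟩
  · intro v hv hlv hvp b hb hs hr
    simp only [List.mem_append, List.mem_singleton, not_or] at hvp
    rw [Function.update_of_ne hvp.2] at hlv ⊢
    by_cases hba : v = u ∧ b = a
    · obtain ⟨rfl, rfl⟩ := hba
      rw [hself]
      exact ⟨by omega, le_rfl⟩
    · have := h.explored v hv hlv hvp.1 b hb (fun hvu => by
        rw [List.mem_cons, not_or]
        exact ⟨fun h => hba ⟨hvu, h⟩, hs hvu⟩) hr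
      rwa [hupd _ this.1]

theorem Frontier.isLevel {G : NumNet} {res lev : ℕ → ℕ}
    (h : Frontier G res lev [] fun _ _ => True) : G.IsLevel res lev where
  source := h.source
  step a ha hr hl := h.explored _ (NumNet.tl_lt ha) hl (by simp) a
    (NumNet.mem_adj.2 ⟨rfl, ha⟩) trivial hr
  pred := h.pred

/-- The memory holds labels, and a queue with the waiting vertices `pend`. -/
structure HoldsQueue (G : NumNet) (res : ℕ → ℕ) (lev : ℕ → ℕ) (pend : List ℕ)
    (σ : Store Reg Arr) : Prop where
  static : Static G σ
  arr_res : σ.arr .res = res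
  arr_level : σ.arr .level = lev
  tail : σ.reg .qt = σ.reg .qh + pend.length
  queue : ∀ j (hj : j < pend.length), σ.arr .queue (σ.reg .qh + j) = pend[j]

/-- The time that is set aside for scanning a vertex, a constant for the vertex and for each of its
arcs. -/
def scanTime (G : NumNet) (v : ℕ) : ℕ := 30 + 60 * (G.adj v).length

/-- The time that is set aside for scanning the vertices that have no label and those that wait in
the queue. -/
def remainingTime (G : NumNet) (lev : ℕ → ℕ) (pend : List ℕ) : ℕ :=
  ∑ v ∈ (Finset.range G.n).filter (fun v => lev v = 0), scanTime G v +
    (pend.map (scanTime G)).sum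

theorem remainingTime_label {G : NumNet} {lev : ℕ → ℕ} {pend : List ℕ} {v k : ℕ} (hv : v < G.n)
    (h : lev v = 0) (hk : k ≠ 0) :
    remainingTime G (Function.update lev v k) (pend ++ [v]) = remainingTime G lev pend := by
  have h₁ : v ∈ (Finset.range G.n).filter (fun v => lev v = 0) := by simp [hv, h]
  have h₂ : ((Finset.range G.n).filter (fun v => lev v = 0)).erase v =
      (Finset.range G.n).filter (fun w => Function.update lev v k w = 0) := by
    ext w
    by_cases hw : w = v
    · subst hw; simp [hk]
    · simp [hw]
  unfold remainingTime
  rw [← Finset.sum_erase_add _ _ h₁, h₂]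
  simp only [List.map_append, List.map_singleton, List.sum_append, List.sum_singleton]
  omega

/-- The loop over the adjacency list of a vertex that has been taken from the queue. -/
def scan : Prog Reg Arr :=
  .loop (.lt 0 (.var .a)) (.seq
    (.assign .v (.read .to (.var .a - 1)))
    (.ite (.and (.eq (.read .level (.var .v)) 0) (.lt 0 (.read .res (.var .a - 1))))
      (.seq (.write .level (.var .v) (.read .level (.var .u) + 1))
        (.seq (.write .queue (.var .qt) (.var .v))
          (.seq (.assign .qt (.var .qt + 1))
            (.assign .a (.read .nxt (.var .a - 1))))))
      (.assign .a (.read .nxt (.var .a - 1)))))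

/-- The scan of a vertex `u` whose level is minimal in the queue and at most one below all
levels. -/
theorem terminates_scan {G : NumNet} {res : ℕ → ℕ} {σ : Store Reg Arr} {lev : ℕ → ℕ}
    {pend : List ℕ} {u : ℕ} (hu : u < G.n) (hlu : lev u ≠ 0) (hup : ∀ v ∈ pend, lev u ≤ lev v)
    (hmax : ∀ v < G.n, lev v ≤ lev u + 1)
    (hr : σ.reg .u = u) (ha : σ.reg .a = σ.arr .first u) (hq : HoldsQueue G res lev pend σ)
    (hf : Frontier G res lev pend fun v _ => v ≠ u) :
    Terminates scan (fun τ σ' => ∃ lev' pend',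
      HoldsQueue G res lev' pend' σ' ∧ (Frontier G res lev' pend' fun _ _ => True) ∧
      (∀ v ∈ pend', ∀ w < G.n, lev' w ≤ lev' v + 1) ∧
      τ + remainingTime G lev' pend' ≤
        60 * (G.adj u).length + 4 + remainingTime G lev pend) σ := by
  unfold scan
  refine (terminates_loop (fun φ σ => ∃ lev' pend' rem,
    HoldsQueue G res lev' pend' σ ∧ (Frontier G res lev' pend' fun v a => v = u → a ∉ rem) ∧
    lev' u ≠ 0 ∧ (∀ v ∈ pend', lev' u ≤ lev' v) ∧ (∀ v < G.n, lev' v ≤ lev' u + 1) ∧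
    σ.reg .u = u ∧ (∀ a ∈ rem, a ∈ G.adj u) ∧ IsList (σ.arr .nxt) (σ.reg .a) rem ∧
    φ = 60 * rem.length + remainingTime G lev' pend') ?_
    ⟨lev, pend, G.adj u, hq, ?_, hlu, hup, hmax, hr, fun _ h => h, ?_, rfl⟩).mono ?_
  · rintro φ σ ⟨lev', pend', rem, hq, hf, hlu, hup, hmax, hru, hrem, hlist, rfl⟩ hb
    have hb : 0 < σ.reg .a := hb
    obtain ⟨a, rem, rfl, ha, hlist⟩ := hlist.exists_cons hb.ne'
    have hadj := NumNet.mem_adj.1 (hrem a (by simp))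
    have hto := hq.static.arcTo a hadj.2
    have hv := NumNet.hd_lt hadj.2
    simp only [terminates_seq, terminates_ite, terminates_write, terminates_assign, Cond.Holds,
      Cond.cost, Store.setReg_reg, Store.setReg_arr, Store.setCell_reg, Store.setCell_arr,
      Expr.eval, Expr.cost, eval_sub, cost_sub, reduceCtorEq, if_true, if_false, ha,
      Nat.add_sub_cancel, hto, hru, hq.arr_level, hq.arr_res]
    constructor
    · rintro ⟨h₀, hres⟩
      have hne : u ≠ G.hd a := by rintro h; rw [← h] at h₀; exact hlu h₀
      refine ⟨_, ⟨Function.update lev' (G.hd a) (lev' u + 1), pend' ++ [G.hd a], rem, ?_,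
        hf.label hmax hadj.2 hadj.1 hlu hres h₀, ?_, ?_, ?_, ?_,
        fun b hb => hrem b (by simp [hb]), ?_, rfl⟩, ?_⟩
      · constructor
        · exact hq.static.congr rfl rfl rfl rfl rfl rfl rfl rfl
        · exact hq.arr_res
        · simp [Store.setReg_arr, Store.setCell_arr, hq.arr_level]
        · simp [Store.setReg_reg, Store.setCell_reg, hq.tail, add_assoc]
        · intro j hj
          simp only [Store.setReg_reg, Store.setReg_arr, Store.setCell_reg, Store.setCell_arr,
            reduceCtorEq, if_true, if_false, hq.tail]
          rcases Nat.lt_or_ge j pend'.length with hj' | hj'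
          · rw [Function.update_of_ne (by omega), hq.queue j hj', List.getElem_append_left hj']
          · have : j = pend'.length := by simp at hj; omega
            subst this
            simp
      · rwa [Function.update_of_ne hne]
      · intro v hv
        rw [Function.update_of_ne hne]
        rcases List.mem_append.1 hv with hv | hv
        · rw [Function.update_of_ne]
          · exact hup v hv
          · rintro rfl; exact (hf.mem _ hv).2 h₀
        · rw [List.mem_singleton.1 hv, Function.update_self]
          omega
      · intro v hv
        rw [Function.update_of_ne hne, Function.update_apply]
        split_ifs
        · exact le_rfl
        · exact hmax v hv
      · trivial
      · exact hlist
      · rw [remainingTime_label hv h₀ (by omega)]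
        simp only [List.length_cons]
        omega
    · intro hcond
      refine ⟨_, ⟨lev', pend', rem, ?_, hf.skip hmax hadj.2 ?_, hlu, hup, hmax, ?_,
        fun b hb => hrem b (by simp [hb]), ?_, rfl⟩, ?_⟩
      · exact ⟨hq.static.congr rfl rfl rfl rfl rfl rfl rfl rfl, hq.arr_res, hq.arr_level, hq.tail,
          hq.queue⟩
      · exact fun hr h₀ => hcond ⟨h₀, hr⟩
      · trivial
      · exact hlist
      · simp only [List.length_cons]
        omega
  · exact ⟨hf.mem, hf.sorted, hf.source, hf.pred, fun v hv hlv hvp a ha hs =>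
      hf.explored v hv hlv hvp a ha fun hvu => hs hvu (hvu ▸ ha)⟩
  · rw [ha]; exact hq.static.list u hu
  · rintro τ σ' ⟨φ', ⟨lev', pend', rem, hq, hf, hlu, hup, hmax, hru, hrem, hlist, rfl⟩, hb, hτ⟩
    have hb : ¬ 0 < σ'.reg .a := hb
    have hrem : rem = [] := hlist.eq_zero_iff.1 (by omega)
    subst hrem
    refine ⟨lev', pend', hq, ⟨hf.mem, hf.sorted, hf.source, hf.pred, fun v hv hlv hvp a ha _ =>
      hf.explored v hv hlv hvp a ha fun _ => List.not_mem_nil⟩, ?_, ?_⟩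
    · intro v hv w hw
      exact (hmax w hw).trans (Nat.add_le_add_right (hup v hv) 1)
    · simp only [Cond.cost, Expr.cost, List.length_nil] at hτ
      have : (0 : Expr Reg Arr).cost = 1 := rfl
      omega

theorem terminates_bfs {G : NumNet} {σ : Store Reg Arr} (h : Static G σ) :
    Terminates bfs (fun τ σ' => τ ≤ 200 * (G.n + G.m + 1) ∧ Static G σ' ∧
      σ'.arr .res = σ.arr .res ∧ G.IsLevel (σ.arr .res) (σ'.arr .level)) σ := by
  set res := σ.arr .res with hres
  unfold bfs
  rw [terminates_seq]
  refine (terminates_forLoop (N := G.n) (c := 4) (e := .var .n) (fun j σ => σ.reg .i = j ∧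
    Static G σ ∧ σ.arr .res = res ∧ ∀ u < j, σ.arr .level u = 0)
    (Nat.zero_le _) (fun j σ h => h.2.1.n) (fun j σ h => h.1) ?_ ?_).mono ?_
  · rintro j σ - hj ⟨h₁, h₂, h₃, h₄⟩
    simp only [terminates_write, Store.setReg_reg, Store.setReg_arr, Store.setCell_reg,
      Store.setCell_arr, Expr.eval, Expr.cost, reduceCtorEq, if_true, if_false, h₁]
    refine ⟨by norm_num, trivial, h₂.congr rfl rfl rfl rfl rfl rfl rfl rfl, h₃, ?_⟩
    intro u hu
    by_cases h : u = j
    · rw [h, Function.update_self]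
    · rw [Function.update_of_ne h]; exact h₄ u (by omega)
  · exact ⟨rfl, h.congr rfl rfl rfl rfl rfl rfl rfl rfl, hres.symm, by simp⟩
  · rintro τ σ₁ ⟨hτ, -, h₂, h₃, h₄⟩
    rw [terminates_seq, terminates_write, terminates_seq, terminates_write, terminates_seq,
      terminates_assign, terminates_seq, terminates_assign]
    set lev := Function.update (σ₁.arr .level) G.s 1 with hlev
    refine (terminates_loop (fun φ σ => ∃ lev pend, HoldsQueue G res lev pend σ ∧
      (Frontier G res lev pend fun _ _ => True) ∧
      (∀ v ∈ pend, ∀ w < G.n, lev w ≤ lev v + 1) ∧ φ = remainingTime G lev pend) ?_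
      ⟨lev, [] ++ [G.s], ?_, ?_, ?_, rfl⟩).mono ?_
    · rintro φ σ ⟨lev, pend, hq, hf, hmax, rfl⟩ hb
      have hb : σ.reg .qh < σ.reg .qt := hb
      rw [hq.tail] at hb
      obtain ⟨u, pend, rfl⟩ := List.exists_cons_of_length_pos (l := pend) (by omega)
      have hu := hf.mem u (by simp)
      have hsorted := List.pairwise_cons.1 hf.sorted
      have hqu : σ.arr .queue (σ.reg .qh) = u := hq.queue 0 (by simp)
      have htail := hq.tail
      rw [terminates_seq, terminates_assign, terminates_seq, terminates_assign, terminates_seq,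
        terminates_assign]
      refine (terminates_scan (lev := lev) (pend := pend) (res := res) hu.1 hu.2 hsorted.1
        (hmax u (by simp)) hqu (by simp [Store.setReg_reg, Store.setReg_arr, Expr.eval, hqu])
        ⟨?_, ?_, ?_, ?_, ?_⟩
        ⟨fun v hv => hf.mem v (by simp [hv]), hsorted.2, hf.source, hf.pred, ?_⟩).mono ?_
      · exact hq.static.congr rfl rfl rfl rfl rfl rfl rfl rfl
      · exact hq.arr_res
      · exact hq.arr_level
      · simp only [Store.setReg_reg, Expr.eval, reduceCtorEq, if_true, if_false]
        simp only [List.length_cons] at htail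
        omega
      · intro j hj
        have := hq.queue (j + 1) (by simpa using hj)
        simp only [Store.setReg_reg, Expr.eval, reduceCtorEq, if_true, if_false, Store.setReg_arr]
        rw [List.getElem_cons_succ] at this
        rw [← this]
        congr 1
        omega
      · intro v hv hlv hvp a ha hvu
        exact hf.explored v hv hlv (by simp [hvp, hvu]) a ha trivial
      · rintro τ' σ' ⟨lev', pend', hq', hf', hmax', hτ'⟩
        refine ⟨_, ⟨lev', pend', hq', hf', hmax', rfl⟩, ?_⟩
        have : remainingTime G lev (u :: pend) =
            30 + 60 * (G.adj u).length + remainingTime G lev pend := by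
          simp only [remainingTime, List.map_cons, List.sum_cons, scanTime]
          omega
        rw [this]
        simp only [Cond.cost, Expr.cost]
        omega
    · constructor
      · exact h₂.congr rfl rfl rfl rfl rfl rfl rfl rfl
      · exact h₃
      · simp [Store.setReg_arr, Store.setCell_arr, hlev, Expr.eval, h₂.s]
      · rfl
      · intro j hj
        have : j = 0 := by simpa using hj
        subst this
        simp [Store.setReg_reg, Store.setReg_arr, Store.setCell_arr, Expr.eval,
          Store.setCell_reg, h₂.s]
    · have hs : lev G.s = 1 := Function.update_self ..
      have h₀ : ∀ v < G.n, lev v ≠ 0 → v = G.s := by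
        intro v hv hlv
        by_contra hne
        rw [hlev, Function.update_of_ne hne] at hlv
        exact hlv (h₄ v hv)
      refine ⟨?_, List.pairwise_singleton _ _, hs, fun v hv hlv => .inl (h₀ v hv hlv), ?_⟩
      · simp [G.s_lt, hs]
      · intro v hv hlv hvp
        exact absurd (h₀ v hv hlv) (by simpa using hvp)
    · intro v hv w hw
      obtain rfl : v = G.s := by simpa using hv
      rw [hlev, Function.update_self, Function.update_apply]
      split_ifs
      · omega
      · rw [h₄ w hw]; omega
    · rintro τ' σ' ⟨φ', ⟨lev', pend, hq, hf, -, rfl⟩, hb, hτ'⟩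
      have hb : ¬ σ'.reg .qh < σ'.reg .qt := hb
      rw [hq.tail] at hb
      obtain rfl : pend = [] := List.length_eq_zero_iff.1 (by omega)
      refine ⟨?_, hq.static, hq.arr_res, ?_⟩
      · have h₅ : remainingTime G lev ([] ++ [G.s]) ≤ 30 * G.n + 120 * G.m := by
          rw [remainingTime_label G.s_lt (h₄ _ G.s_lt) one_ne_zero]
          have h₆ : ∑ v ∈ Finset.range G.n, scanTime G v = 30 * G.n + 120 * G.m := by
            simp only [scanTime, Finset.sum_add_distrib, ← Finset.mul_sum,
              NumNet.sum_length_adj, Finset.sum_const, Finset.card_range, smul_eq_mul]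
            omega
          rw [← h₆]
          unfold remainingTime
          rw [List.map_nil, List.sum_nil, add_zero]
          exact Finset.sum_le_sum_of_subset (Finset.filter_subset _ _)
        simp only [Cond.cost, Expr.cost] at hτ hτ' ⊢
        have : (0 : Expr Reg Arr).cost = 1 := rfl
        have : (1 : Expr Reg Arr).cost = 1 := rfl
        omega
      · rw [hq.arr_level]; exact hf.isLevel

end Dinic

/-! ### Blocking flows -/

namespace Dinic

open RAM

namespace NumNet

variable {G : NumNet}

theorem LevelWalk.pos {lev : ℕ → ℕ} (hs : lev G.s ≠ 0) {p : List ℕ} {v : ℕ}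
    (h : G.LevelWalk lev p v) : lev v ≠ 0 ∧ ∀ a ∈ p, lev (G.tl a) ≠ 0 := by
  induction h with
  | nil => simpa using hs
  | @snoc p b h₁ h₂ h₃ ih =>
    refine ⟨by omega, fun a ha => ?_⟩
    rcases List.mem_append.1 ha with ha | ha
    · exact ih.2 a ha
    · obtain rfl := List.mem_singleton.1 ha
      exact ih.1

end NumNet

/-- The arcs of the level graph that have positive residual capacity. -/
def levelArcs (G : NumNet) (lev res : ℕ → ℕ) : Finset ℕ :=
  (Finset.range (2 * G.m)).filter fun a => res a = 1 ∧ lev (G.hd a) = lev (G.tl a) + 1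

/-- The invariant of the depth-first search: `p` is the current path, which ends in `u`, and `suf v`
is the part of the adjacency list of `v` from the current arc on. The arcs before the current arc
are useless for the rest of the phase. -/
structure SearchState (G : NumNet) (lev res₀ res : ℕ → ℕ) (suf : ℕ → List ℕ) (p : List ℕ)
    (u : ℕ) : Prop where
  source : lev G.s = 1
  walk : G.LevelWalk lev p u
  path : ∀ a ∈ p, res a = 1 ∧ ∃ l, suf (G.tl a) = a :: l
  residual : G.IsResidual res
  old_or_back : ∀ a < 2 * G.m, 0 < res a → 0 < res₀ a ∨
    lev (G.hd a) ≠ 0 ∧ lev (G.tl a) = lev (G.hd a) + 1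
  value : res = res₀ ∨ G.value res₀ + 1 ≤ G.value res
  mem_adj : ∀ v, ∀ a ∈ suf v, a ∈ G.adj v
  useless : ∀ v, ∀ a ∈ G.adj v, a ∉ suf v →
    res a = 0 ∨ lev (G.hd a) ≠ lev v + 1 ∨ G.hd a ≠ G.t ∧ suf (G.hd a) = []

namespace SearchState

variable {G : NumNet} {lev res₀ res : ℕ → ℕ} {suf : ℕ → List ℕ} {p l : List ℕ} {u a : ℕ}

/-- The search moves on to the next arc of `u`. -/
theorem pop (h : SearchState G lev res₀ res suf p u) (hl : suf u = a :: l)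
    (ha : res a = 0 ∨ lev (G.hd a) ≠ lev u + 1 ∨ G.hd a ≠ G.t ∧ suf (G.hd a) = []) :
    SearchState G lev res₀ res (Function.update suf u l) p u where
  source := h.source
  walk := h.walk
  path b hb := by
    rw [Function.update_of_ne]
    · exact h.path b hb
    · have := (h.walk.mem b hb).2.2
      rintro h'
      rw [h'] at this
      exact lt_irrefl _ this
  residual := h.residual
  old_or_back := h.old_or_back
  value := h.value
  mem_adj v b hb := by
    by_cases hv : v = u
    · subst hv
      rw [Function.update_self] at hb
      exact h.mem_adj v b (by simp [hl, hb])
    · rw [Function.update_of_ne hv] at hb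
      exact h.mem_adj v b hb
  useless v b hb hbs := by
    have key : res b = 0 ∨ lev (G.hd b) ≠ lev v + 1 ∨ G.hd b ≠ G.t ∧ suf (G.hd b) = [] := by
      by_cases hv : v = u
      · subst hv
        rw [Function.update_self] at hbs
        by_cases hba : b = a
        · subst hba; exact ha
        · exact h.useless v b hb (by simp [hl, hba, hbs])
      · rw [Function.update_of_ne hv] at hbs
        exact h.useless v b hb hbs
    refine key.imp_right (Or.imp_right (And.imp_right fun h' => ?_))
    rwa [Function.update_of_ne]
    rintro h''
    rw [h'', hl] at h'
    exact List.cons_ne_nil _ _ h'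

/-- The search follows an arc of the level graph. -/
theorem advance (h : SearchState G lev res₀ res suf p u) (hl : suf u = a :: l)
    (hr : 0 < res a) (ha : lev (G.hd a) = lev u + 1) :
    SearchState G lev res₀ res suf (p ++ [a]) (G.hd a) := by
  obtain ⟨htl, ha'⟩ := NumNet.mem_adj.1 (h.mem_adj u a (by simp [hl]))
  refine { h with walk := ?_, path := ?_ }
  · subst htl
    exact h.walk.snoc ha' ha
  · intro b hb
    rcases List.mem_append.1 hb with hb | hb
    · exact h.path b hb
    · obtain rfl := List.mem_singleton.1 hb
      have := NumNet.IsResidual.add_rev h.residual.pair ha'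
      exact ⟨by omega, l, by rw [htl, hl]⟩

/-- The search gives up the last arc of the path. -/
theorem back (h : SearchState G lev res₀ res suf (p ++ [a]) u) :
    SearchState G lev res₀ res suf p (G.tl a) ∧ u = G.hd a ∧
      ∃ l, suf (G.tl a) = a :: l := by
  obtain ⟨h₁, -, -, h₂⟩ := h.walk.snoc_inv
  exact ⟨{ h with walk := h₁, path := fun b hb => h.path b (by simp [hb]) }, h₂,
    (h.path a (by simp)).2⟩

/-- The arcs of the path, which are distinct because the levels increase, are among those that still
can be saturated. -/
theorem path_subset (h : SearchState G lev res₀ res suf p u) :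
    p.toFinset ⊆ levelArcs G lev res := by
  intro a ha
  rw [List.mem_toFinset] at ha
  obtain ⟨h₁, h₂, -⟩ := h.walk.mem a ha
  simp only [levelArcs, Finset.mem_filter, Finset.mem_range]
  exact ⟨h₁, (h.path a ha).1, h₂⟩

theorem length_le (h : SearchState G lev res₀ res suf p u) :
    p.length ≤ (levelArcs G lev res).card := by
  rw [← List.toFinset_card_of_nodup h.walk.nodup]
  exact Finset.card_le_card h.path_subset

/-- The flow is augmented along the path, all of whose arcs become saturated, and the search
resumes at the source. -/
theorem augment (h : SearchState G lev res₀ res suf p G.t) :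
    SearchState G lev res₀ (p.foldl G.push res) suf [] G.s ∧
    (levelArcs G lev (p.foldl G.push res)).card + p.length ≤ (levelArcs G lev res).card := by
  obtain ⟨h₁, h₂, h₃, h₄⟩ := h.walk.foldl_push h.residual.pair fun a ha => (h.path a ha).1
  set r := p.foldl G.push res with hr
  have hpos := (h.walk.pos (by rw [h.source]; exact one_ne_zero)).2
  have hback : ∀ x < 2 * G.m, G.rev x ∈ p →
      lev (G.hd x) ≠ 0 ∧ lev (G.tl x) = lev (G.hd x) + 1 := by
    intro x hx hxp
    have h₅ := (h.walk.mem _ hxp).2.1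
    have h₆ := hpos _ hxp
    rw [NumNet.hd_rev hx, NumNet.tl_rev hx] at h₅
    rw [NumNet.tl_rev hx] at h₆
    exact ⟨h₆, h₅⟩
  have hval : G.value r = G.value res + 1 := by
    unfold NumNet.value
    rw [h₄, if_pos rfl, if_neg G.s_ne_t.symm]
    ring
  refine ⟨⟨h.source, .nil, by simp, ⟨h₁, ?_⟩, ?_, .inr ?_, h.mem_adj, ?_⟩, ?_⟩
  · intro w hs ht
    rw [h₄, h.residual.conserved w hs ht, if_neg hs.symm, if_neg ht.symm]
    ring
  · intro x hx hrx
    by_cases hxp : x ∈ p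
    · have := h₂ x hxp
      omega
    · by_cases hxr : G.rev x ∈ p
      · exact .inr (hback x hx hxr)
      · rw [h₃ x hx hxp hxr] at hrx
        exact h.old_or_back x hx hrx
  · rcases h.value with h₅ | h₅
    · rw [hval, h₅]
    · rw [hval]; linarith
  · intro v x hxv hx
    obtain ⟨htl, hx'⟩ := NumNet.mem_adj.1 hxv
    by_cases hxp : x ∈ p
    · exact .inl (h₂ x hxp)
    · by_cases hxr : G.rev x ∈ p
      · have := (hback x hx' hxr).2
        rw [htl] at this
        exact .inr (.inl (by omega))
      · rw [h₃ x hx' hxp hxr]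
        exact h.useless v x hxv hx
  · have hsub : levelArcs G lev r ⊆ levelArcs G lev res \ p.toFinset := by
      intro x hx
      simp only [levelArcs, Finset.mem_filter, Finset.mem_range, Finset.mem_sdiff,
        List.mem_toFinset] at hx ⊢
      obtain ⟨hx, hrx, hlx⟩ := hx
      have hxp : x ∉ p := fun hxp => by have := h₂ x hxp; omega
      have hxr : G.rev x ∉ p := fun hxr => by have := (hback x hx hxr).2; omega
      rw [h₃ x hx hxp hxr] at hrx
      exact ⟨⟨hx, hrx, hlx⟩, hxp⟩
    have := Finset.card_le_card hsub
    rw [Finset.card_sdiff_of_subset h.path_subset,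
      List.toFinset_card_of_nodup h.walk.nodup] at this
    have := h.length_le
    omega

theorem isBlocked (h : SearchState G lev res₀ res suf [] u) (hut : u ≠ G.t) (hu : suf u = []) :
    G.IsBlocked res₀ lev res where
  old_or_back := h.old_or_back
  dead := by
    refine ⟨fun v => v ≠ G.t ∧ suf v = [], ?_, fun h => h.1 rfl, ?_⟩
    · rw [← h.walk.nil_inv]; exact ⟨hut, hu⟩
    · intro a ha hr hd hl
      rcases h.useless _ a (NumNet.mem_adj.2 ⟨rfl, ha⟩) (by simp [hd.2]) with h' | h' | h'
      · omega
      · exact absurd hl h'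
      · exact h'

end SearchState

/-- The memory holds the path `p` of residual arcs. -/
def HoldsPath (p : List ℕ) (σ : Store Reg Arr) : Prop :=
  σ.reg .len = p.length ∧ ∀ j (hj : j < p.length), σ.arr .path j = p[j]

/-- If all arcs of the path have residual capacity one, `augment` pushes one unit along it. -/
theorem terminates_augment {G : NumNet} {σ : Store Reg Arr} {p : List ℕ} (hσ : Static G σ)
    (hp : HoldsPath p σ) (hne : p ≠ []) (hlt : ∀ a ∈ p, a < 2 * G.m)
    (hres : ∀ a ∈ p, σ.arr .res a = 1) :
    Terminates augment (fun τ σ' => τ ≤ 80 * p.length + 20 ∧ Static G σ' ∧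
      σ'.arr .res = p.foldl G.push (σ.arr .res) ∧ σ'.arr .level = σ.arr .level ∧
      σ'.arr .cur = σ.arr .cur ∧ σ'.arr .nxt = σ.arr .nxt ∧ σ'.reg .run = σ.reg .run) σ := by
  have hpos := List.length_pos_iff.2 hne
  unfold augment
  rw [terminates_seq, terminates_assign, terminates_seq]
  refine (terminates_forLoop (N := p.length) (c := 20) (e := .var .len) (fun j σ' =>
    σ'.reg .i = j ∧ σ'.reg .b = 1 ∧ σ'.arr = σ.arr ∧ Static G σ' ∧ σ'.reg .len = p.length ∧
    σ'.reg .run = σ.reg .run)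
    hpos (fun j σ h => h.2.2.2.2.1) (fun j σ h => h.1) ?_ ?_).mono ?_
  · rintro j σ' h₀ hj ⟨h₁, h₂, h₃, h₄, h₅, h₆⟩
    have h₇ : σ.arr .res (σ.arr .path j) = 1 := by
      rw [hp.2 j hj]; exact hres _ (List.getElem_mem hj)
    rw [terminates_ite]
    simp only [Cond.Holds, Expr.eval, h₁, h₂, h₃, h₇, lt_irrefl, false_imp_iff, not_false_eq_true,
      true_imp_iff, true_and, terminates_assign, Expr.cost, Cond.cost, Store.setReg_reg,
      Store.setReg_arr, reduceCtorEq, if_true, if_false, h₅, h₆]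
    exact ⟨by norm_num, h₄.congr rfl rfl rfl rfl rfl rfl rfl rfl, trivial⟩
  · refine ⟨rfl, ?_, rfl, hσ.congr rfl rfl rfl rfl rfl rfl rfl rfl, hp.1, rfl⟩
    have h₇ : σ.arr .res (σ.arr .path 0) = 1 := by
      rw [hp.2 0 hpos]; exact hres _ (List.getElem_mem hpos)
    exact h₇
  · rintro τ σ₁ ⟨hτ, -, hb, harr, hst, hlen, hrun⟩
    refine (terminates_forLoop (N := p.length) (c := 40) (e := .var .len) (fun j σ' =>
      σ'.reg .i = j ∧ σ'.reg .b = 1 ∧ Static G σ' ∧ HoldsPath p σ' ∧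
      σ'.arr .res = (p.take j).foldl G.push (σ.arr .res) ∧ σ'.arr .level = σ.arr .level ∧
      σ'.arr .cur = σ.arr .cur ∧ σ'.arr .nxt = σ.arr .nxt ∧ σ'.reg .run = σ.reg .run)
      (Nat.zero_le _) (fun j σ h => h.2.2.2.1.1) (fun j σ h => h.1) ?_ ?_).mono ?_
    · rintro j σ' - hj ⟨h₁, h₂, h₃, h₄, h₅, h₆, h₇, hx, h₈⟩
      have h₉ := h₄.2 j hj
      have hm := hlt _ (List.getElem_mem hj)
      simp only [terminates_seq, terminates_write, terminates_assign, Expr.eval,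
        eval_sub, Expr.cost, cost_sub, Store.setReg_reg, Store.setReg_arr, Store.setCell_reg,
        Store.setCell_arr, reduceCtorEq, if_true, if_false, h₁, h₂, h₉, h₃.arcRev _ hm,
        h₆, h₇, hx, h₈]
      refine ⟨by norm_num, trivial, trivial, h₃.congr rfl rfl rfl rfl rfl rfl rfl rfl, h₄, ?_,
        trivial, trivial, trivial, trivial⟩
      rw [h₅, List.take_add_one, List.getElem?_eq_getElem hj, Option.toList_some,
        List.foldl_append, List.foldl_cons, List.foldl_nil]
      unfold NumNet.push
      rw [Function.update_of_ne (NumNet.rev_ne hm)]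
    · refine ⟨rfl, hb, hst.congr rfl rfl rfl rfl rfl rfl rfl rfl, ⟨hlen, ?_⟩, ?_, ?_, ?_, ?_, hrun⟩
      · simpa [Store.setReg_arr, harr] using hp.2
      · simp [Store.setReg_arr, harr]
      · simp [Store.setReg_arr, harr]
      · simp [Store.setReg_arr, harr]
      · simp [Store.setReg_arr, harr]
    · rintro τ' σ₂ ⟨hτ', h₁, h₂, h₃, h₄, h₅, h₆, h₇, hx, h₈⟩
      rw [List.take_length] at h₅
      refine ⟨?_, h₃, h₅, h₆, h₇, hx, h₈⟩
      simp only [Expr.cost] at hτ hτ' ⊢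
      have : (0 : Expr Reg Arr).cost = 1 := rfl
      omega

/-- The memory holds the state of the depth-first search. -/
structure HoldsSearch (G : NumNet) (lev res : ℕ → ℕ) (suf : ℕ → List ℕ) (p : List ℕ) (u run : ℕ)
    (σ : Store Reg Arr) : Prop where
  static : Static G σ
  arr_res : σ.arr .res = res
  arr_level : σ.arr .level = lev
  cur : ∀ v < G.n, IsList (σ.arr .nxt) (σ.arr .cur v) (suf v)
  path : HoldsPath p σ
  reg_u : σ.reg .u = u
  reg_run : σ.reg .run = run

/-- The number of arcs that the search has not passed. -/
def arcsLeft (G : NumNet) (suf : ℕ → List ℕ) : ℕ := ∑ v ∈ Finset.range G.n, (suf v).length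

theorem arcsLeft_update {G : NumNet} {suf : ℕ → List ℕ} {u a : ℕ} {l : List ℕ} (hu : u < G.n)
    (h : suf u = a :: l) : arcsLeft G (Function.update suf u l) + 1 = arcsLeft G suf := by
  unfold arcsLeft
  have hu := Finset.mem_range.2 hu
  rw [← Finset.add_sum_erase _ _ hu, ← Finset.add_sum_erase _ _ hu, Function.update_self, h,
    List.length_cons, Finset.sum_congr rfl fun v hv => by
      rw [Function.update_of_ne (Finset.ne_of_mem_erase hv)]]
  omega

/-- The potential of the depth-first search. An arc pays when it is passed, and an arc of the level
graph when it is saturated; the arcs of the current path have paid a part in advance, when the path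
was extended. The subtraction is never truncated, because the path consists of arcs of
`levelArcs`. -/
def searchTime (G : NumNet) (lev res : ℕ → ℕ) (suf : ℕ → List ℕ) (p : List ℕ) (run : ℕ) : ℕ :=
  100 * run + 300 * arcsLeft G suf + 300 * (levelArcs G lev res).card - 100 * p.length

/-- One step of the depth-first search. -/
def searchStep : Prog Reg Arr :=
  .ite (.eq (.var .u) (.var .t))
    (.seq augment
      (.seq (.assign .len 0)
        (.assign .u (.var .s))))
    (.seq (.assign .a (.read .cur (.var .u)))
      (.ite (.eq (.var .a) 0)
        (.ite (.eq (.var .len) 0)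
          (.assign .run 0)
          (.seq (.assign .len (.var .len - 1))
            (.seq (.assign .u (.read .to (.read .rev (.read .path (.var .len)))))
              (.write .cur (.var .u) (.read .nxt (.read .cur (.var .u) - 1))))))
        (.seq (.assign .v (.read .to (.var .a - 1)))
          (.ite (.and (.lt 0 (.read .res (.var .a - 1)))
              (.eq (.read .level (.var .v)) (.read .level (.var .u) + 1)))
            (.seq (.write .path (.var .len) (.var .a - 1))
              (.seq (.assign .len (.var .len + 1))
                (.assign .u (.var .v))))
            (.write .cur (.var .u) (.read .nxt (.var .a - 1)))))))

/-- What holds between the steps of the depth-first search. -/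
def SearchInv (G : NumNet) (lev res₀ : ℕ → ℕ) (φ : ℕ) (σ : Store Reg Arr) : Prop :=
  ∃ res suf p u run, HoldsSearch G lev res suf p u run σ ∧
    SearchState G lev res₀ res suf p u ∧ run ≤ 1 ∧
    (run = 0 → u ≠ G.t ∧ suf u = [] ∧ p = []) ∧ φ = searchTime G lev res suf p run

/-- Each step of the search, and the test of the loop, which takes 4 units, is paid for by the
potential. -/
theorem terminates_searchStep {G : NumNet} {lev res₀ : ℕ → ℕ} {φ : ℕ} {σ : Store Reg Arr}
    (h : SearchInv G lev res₀ φ σ) (hrun : σ.reg .run = 1) :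
    Terminates searchStep
      (fun τ σ' => ∃ φ', SearchInv G lev res₀ φ' σ' ∧ τ + φ' + 4 ≤ φ) σ := by
  obtain ⟨res, suf, p, u, run, hq, hs, -, -, rfl⟩ := h
  obtain rfl : run = 1 := hq.reg_run.symm.trans hrun
  have hu := hs.walk.lt
  have hle := hs.length_le
  unfold searchStep
  rw [terminates_ite]
  simp only [Cond.Holds, Cond.cost, Expr.eval, Expr.cost, hq.reg_u, hq.static.t]
  constructor
  · rintro rfl
    have hne : p ≠ [] := by
      rintro rfl
      exact G.s_ne_t hs.walk.nil_inv.symm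
    have hpos := List.length_pos_iff.2 hne
    obtain ⟨hs', hcard⟩ := hs.augment
    rw [terminates_seq]
    refine (terminates_augment hq.static hq.path hne (fun a ha => (hs.walk.mem a ha).1)
      (fun a ha => by rw [hq.arr_res]; exact (hs.path a ha).1)).mono ?_
    rintro τ σ₁ ⟨hτ, h₁, h₂, h₃, h₄, hx, h₅⟩
    simp only [terminates_seq, terminates_assign, Expr.eval, Expr.cost, Store.setReg_reg,
      reduceCtorEq, if_false, h₁.s]
    refine ⟨_, ⟨_, suf, [], G.s, 1, ⟨h₁.congr rfl rfl rfl rfl rfl rfl rfl rfl, rfl, ?_, ?_,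
      ⟨rfl, by simp⟩, rfl, h₅.trans hrun⟩, ?_, le_rfl, by simp, rfl⟩, ?_⟩
    · exact h₃.trans hq.arr_level
    · intro v hv
      simp only [Store.setReg_arr, h₄, hx]
      exact hq.cur v hv
    · have : σ₁.arr .res = p.foldl G.push res := by rw [h₂, hq.arr_res]
      simp only [Store.setReg_arr, this]
      exact hs'
    · simp only [Store.setReg_arr, h₂, hq.arr_res, searchTime, List.length_nil]
      omega
  · intro hut
    simp only [terminates_seq, terminates_ite, terminates_write, terminates_assign, Cond.Holds,
      Cond.cost, Store.setReg_reg, Store.setReg_arr, Store.setCell_reg, Expr.eval, Expr.cost,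
      eval_sub, cost_sub, reduceCtorEq, if_true, if_false, hq.reg_u,
      hq.arr_level, hq.arr_res]
    refine ⟨fun hcur => ⟨fun hlen => ?_, fun hlen => ?_⟩, fun hcur => ?_⟩
    · have hsuf := (hq.cur u hu).eq_zero_iff.1 hcur
      obtain rfl : p = [] := List.length_eq_zero_iff.1 (hq.path.1.symm.trans hlen)
      refine ⟨_, ⟨res, suf, [], u, 0, ⟨hq.static.congr rfl rfl rfl rfl rfl rfl rfl rfl,
        hq.arr_res, hq.arr_level, hq.cur, hq.path, hq.reg_u, rfl⟩, hs, zero_le_one,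
        fun _ => ⟨hut, hsuf, rfl⟩, rfl⟩, ?_⟩
      simp only [searchTime, List.length_nil]
      have : (0 : Expr Reg Arr).cost = 1 := rfl
      omega
    · have hsuf := (hq.cur u hu).eq_zero_iff.1 hcur
      obtain rfl | ⟨p, a, rfl⟩ := p.eq_nil_or_concat'
      · exact absurd hq.path.1 hlen
      obtain ⟨hs', rfl, l, hl⟩ := hs.back
      have ha := (hs.walk.mem a (by simp)).1
      have hlen' : σ.reg .len - 1 = p.length := by
        rw [hq.path.1]; simp
      have hpath : σ.arr .path p.length = a := by
        rw [hq.path.2 _ (by simp)]; simp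
      have htl := NumNet.tl_lt ha
      have hcur' := hq.cur _ htl
      rw [hl] at hcur'
      simp only [hlen', hpath, hq.static.arcRev a ha, hq.static.arcTo _ (NumNet.rev_lt ha),
        NumNet.hd_rev ha, hcur'.1, Nat.add_sub_cancel]
      refine ⟨_, ⟨res, Function.update suf (G.tl a) l, p, G.tl a, 1,
        ⟨hq.static.congr rfl rfl rfl rfl rfl rfl rfl rfl,
        hq.arr_res, hq.arr_level, ?_, ⟨rfl, ?_⟩, rfl, hrun⟩, hs'.pop hl (.inr (.inr ⟨hut, hsuf⟩)),
        le_rfl, by simp, rfl⟩, ?_⟩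
      · intro v hv
        simp only [Store.setCell_arr, Store.setReg_arr, reduceCtorEq, if_true, if_false]
        by_cases hv' : v = G.tl a
        · subst hv'
          rw [Function.update_self, Function.update_self]
          exact hcur'.2
        · rw [Function.update_of_ne hv', Function.update_of_ne hv']
          exact hq.cur v hv
      · intro j hj
        have := hq.path.2 j (by simp; omega)
        rw [List.getElem_append_left hj] at this
        exact this
      · have := arcsLeft_update htl hl
        simp only [searchTime, List.length_append, List.length_singleton] at hle ⊢
        have : (0 : Expr Reg Arr).cost = 1 := rfl
        have : (1 : Expr Reg Arr).cost = 1 := rfl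
        omega
    · obtain ⟨a, l, hl, ha, hlist⟩ := (hq.cur u hu).exists_cons hcur
      obtain ⟨htl, ha'⟩ := NumNet.mem_adj.1 (hs.mem_adj u a (by simp [hl]))
      simp only [ha, Nat.add_sub_cancel, hq.static.arcTo a ha']
      refine ⟨fun ⟨hr, hlev⟩ => ?_, fun hcond => ?_⟩
      · have hs' := hs.advance hl hr hlev
        refine ⟨_, ⟨res, suf, p ++ [a], G.hd a, 1, ⟨hq.static.congr rfl rfl rfl rfl rfl rfl rfl rfl,
          hq.arr_res, hq.arr_level, hq.cur, ⟨?_, ?_⟩, rfl, hrun⟩, hs', le_rfl, by simp, rfl⟩, ?_⟩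
        · simp [Store.setReg_reg, hq.path.1]
        · intro j hj
          simp only [Store.setCell_arr, Store.setReg_arr, if_true, hq.path.1]
          rcases Nat.lt_or_ge j p.length with hj' | hj'
          · rw [Function.update_of_ne (by omega), hq.path.2 j hj', List.getElem_append_left hj']
          · obtain rfl : j = p.length := by simp at hj; omega
            simp
        · have hle' := hs'.length_le
          simp only [searchTime, List.length_append, List.length_singleton] at hle' ⊢
          have : (0 : Expr Reg Arr).cost = 1 := rfl
          have : (1 : Expr Reg Arr).cost = 1 := rfl
          omega
      · refine ⟨_, ⟨res, Function.update suf u l, p, u, 1,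
          ⟨hq.static.congr rfl rfl rfl rfl rfl rfl rfl rfl, hq.arr_res, hq.arr_level, ?_, hq.path,
          hq.reg_u, hrun⟩, hs.pop hl ?_, le_rfl, by simp, rfl⟩, ?_⟩
        · intro v hv
          simp only [Store.setCell_arr, Store.setReg_arr, if_true]
          by_cases hv' : v = u
          · subst hv'
            rw [Function.update_self, Function.update_self]
            exact hlist
          · rw [Function.update_of_ne hv', Function.update_of_ne hv']
            exact hq.cur v hv
        · by_cases hr : 0 < res a
          · exact .inr (.inl fun hlev => hcond ⟨hr, hlev⟩)
          · exact .inl (by omega)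
        · have := arcsLeft_update hu hl
          simp only [searchTime]
          have : (0 : Expr Reg Arr).cost = 1 := rfl
          have : (1 : Expr Reg Arr).cost = 1 := rfl
          omega

/-- The search takes linear time and ends with a blocking flow. -/
theorem terminates_blockingFlow {G : NumNet} {σ : Store Reg Arr} (h : Static G σ)
    (hres : G.IsResidual (σ.arr .res)) (hlev : G.IsLevel (σ.arr .res) (σ.arr .level)) :
    Terminates blockingFlow (fun τ σ' => τ ≤ 2000 * (G.n + G.m + 1) ∧ Static G σ' ∧
      G.IsResidual (σ'.arr .res) ∧
      G.IsBlocked (σ.arr .res) (σ.arr .level) (σ'.arr .res) ∧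
      (σ'.arr .res = σ.arr .res ∨ G.value (σ.arr .res) + 1 ≤ G.value (σ'.arr .res))) σ := by
  set res := σ.arr .res with hres'
  set lev := σ.arr .level with hlev'
  unfold blockingFlow
  rw [terminates_seq]
  refine (terminates_forLoop (N := G.n) (c := 10) (e := .var .n) (fun j σ => σ.reg .i = j ∧
    Static G σ ∧ σ.arr .res = res ∧ σ.arr .level = lev ∧
    ∀ u < j, σ.arr .cur u = σ.arr .first u)
    (Nat.zero_le _) (fun j σ h => h.2.1.n) (fun j σ h => h.1) ?_ ?_).mono ?_
  · rintro j σ - hj ⟨h₁, h₂, h₃, h₄, h₅⟩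
    simp only [terminates_write, Store.setReg_reg, Store.setReg_arr, Store.setCell_reg,
      Store.setCell_arr, Expr.eval, Expr.cost, reduceCtorEq, if_true, if_false, h₁]
    refine ⟨by norm_num, trivial, h₂.congr rfl rfl rfl rfl rfl rfl rfl rfl, h₃, h₄, ?_⟩
    intro u hu
    by_cases h : u = j
    · rw [h, Function.update_self]
    · rw [Function.update_of_ne h]; exact h₅ u (by omega)
  · exact ⟨rfl, h.congr rfl rfl rfl rfl rfl rfl rfl rfl, hres'.symm, hlev'.symm, by simp⟩
  · rintro τ σ₁ ⟨hτ, -, h₂, h₃, h₄, h₅⟩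
    rw [terminates_seq, terminates_assign, terminates_seq, terminates_assign, terminates_seq,
      terminates_assign]
    refine (terminates_loop (p := searchStep) (SearchInv G lev res) ?_
      ⟨res, G.adj, [], G.s, 1, ⟨?_, ?_, ?_, ?_, ⟨rfl, by simp⟩, ?_, rfl⟩, ?_, le_rfl, by simp,
        rfl⟩).mono ?_
    · intro φ σ hI hb
      refine (terminates_searchStep hI hb).mono ?_
      rintro τ σ' ⟨φ', hI', hφ⟩
      refine ⟨φ', hI', ?_⟩
      simp only [Cond.cost, Expr.cost]
      have : (1 : Expr Reg Arr).cost = 1 := rfl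
      omega
    · exact h₂.congr rfl rfl rfl rfl rfl rfl rfl rfl
    · exact h₃
    · exact h₄
    · intro v hv
      have := h₂.list v hv
      rw [← h₅ v hv] at this
      exact this
    · exact h₂.s
    · exact ⟨hlev.source, .nil, by simp, hres, fun a _ hr => .inl hr, .inl rfl, fun v a ha => ha,
        fun v a ha ha' => absurd ha ha'⟩
    · rintro τ' σ' ⟨φ', ⟨res', suf, p, u, run, hq, hs, hrun, hend, rfl⟩, hb, hτ'⟩
      have hb : ¬ σ'.reg .run = 1 := hb
      rw [hq.reg_run] at hb
      obtain ⟨hut, hsuf, rfl⟩ := hend (by omega)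
      refine ⟨?_, hq.static, ?_⟩
      · have h₆ : (levelArcs G lev res).card ≤ 2 * G.m := by
          refine (Finset.card_filter_le _ _).trans ?_
          rw [Finset.card_range]
        have h₇ : arcsLeft G G.adj = 2 * G.m := NumNet.sum_length_adj
        simp only [Cond.cost, Expr.cost, searchTime, h₇, List.length_nil] at hτ hτ' ⊢
        have : (0 : Expr Reg Arr).cost = 1 := rfl
        have : (1 : Expr Reg Arr).cost = 1 := rfl
        omega
      · rw [hq.arr_res]
        exact ⟨hs.residual, hs.isBlocked hut hsuf, hs.value⟩

end Dinic

/-! ### The phases -/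

namespace Dinic

open RAM

/-- What holds between the phases: the memory holds residual capacities and their levels. -/
structure PhaseInv (G : NumNet) (σ : Store Reg Arr) : Prop where
  static : Static G σ
  residual : G.IsResidual (σ.arr .res)
  level : G.IsLevel (σ.arr .res) (σ.arr .level)

/-- A phase takes linear time, increases the value of the flow, and moves the sink away. -/
theorem terminates_phase {G : NumNet} {σ : Store Reg Arr} (h : PhaseInv G σ)
    (ht : σ.arr .level G.t ≠ 0) :
    Terminates (.seq blockingFlow bfs) (fun τ σ' => τ ≤ 2200 * (G.n + G.m + 1) ∧ PhaseInv G σ' ∧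
      G.value (σ.arr .res) + 1 ≤ G.value (σ'.arr .res) ∧
      (σ'.arr .level G.t ≠ 0 → σ.arr .level G.t < σ'.arr .level G.t)) σ := by
  rw [terminates_seq]
  refine (terminates_blockingFlow h.static h.residual h.level).mono ?_
  rintro τ σ₁ ⟨hτ, h₁, h₂, h₃, h₄⟩
  refine (terminates_bfs h₁).mono ?_
  rintro τ' σ₂ ⟨hτ', h₅, h₆, h₇⟩
  rw [h₆]
  refine ⟨by omega, ⟨h₅, h₆ ▸ h₂, h₆ ▸ h₇⟩, h₄.resolve_left fun heq => ?_,
    h.level.lt_of_isBlocked h₇ h₃⟩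
  -- If the flow had not changed, the old levels would still be valid, and the sink would have moved
  -- away from itself.
  rw [heq] at h₃
  exact lt_irrefl _ (h.level.lt_of_isBlocked h.level h₃ ht)

/-- There are at most `k + 2 + n / k` phases, for every `k`. -/
theorem terminates_phases {G : NumNet} (hG : G.IsType2) {k : ℕ} (hk : 0 < k)
    {σ : Store Reg Arr} (h : PhaseInv G σ) :
    Terminates (.loop (.not (.eq (.read .level (.var .t)) 0)) (.seq blockingFlow bfs))
      (fun τ σ' => τ ≤ 2210 * (G.n + G.m + 1) * (k + 2 + G.n / k) + 10 ∧ PhaseInv G σ' ∧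
        σ'.arr .level G.t = 0) σ := by
  -- The potential counts the remaining phases: as long as the sink is near, by the distance that it
  -- can still move; afterwards, by the value that can still be gained.
  refine (terminates_loop (fun φ σ => PhaseInv G σ ∧ ∃ r, φ = 2210 * (G.n + G.m + 1) * r ∧
    ((∃ i, k + 2 ≤ σ.arr .level G.t + i ∧ r = i + G.n / k) ∨
      ∀ g, G.IsFlow g → G.excess g G.s ≤ G.value (σ.arr .res) + r)) ?_
    ⟨h, _, rfl, .inl ⟨k + 2, by omega, rfl⟩⟩).mono ?_
  · rintro φ σ ⟨h, r, rfl, hr⟩ hb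
    have ht : σ.arr .level G.t ≠ 0 := by
      have : ¬ σ.arr .level (σ.reg .t) = 0 := hb
      rwa [h.static.t] at this
    refine (terminates_phase h ht).mono ?_
    rintro τ σ' ⟨hτ, h', hval, hlev⟩
    suffices hs : ∃ r', r' + 1 ≤ r ∧ ((∃ i, k + 2 ≤ σ'.arr .level G.t + i ∧ r' = i + G.n / k) ∨
        ∀ g, G.IsFlow g → G.excess g G.s ≤ G.value (σ'.arr .res) + r') by
      obtain ⟨r', hr', hs⟩ := hs
      refine ⟨_, ⟨h', r', rfl, hs⟩, ?_⟩
      have h₁ := Nat.mul_le_mul_left (2210 * (G.n + G.m + 1)) hr'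
      rw [mul_add, mul_one] at h₁
      simp only [Cond.cost, Expr.cost]
      have : (0 : Expr Reg Arr).cost = 1 := rfl
      omega
    have hgain : (∀ g, G.IsFlow g → G.excess g G.s ≤ G.value (σ.arr .res) + r) →
        ∃ r', r' + 1 ≤ r ∧
          ∀ g, G.IsFlow g → G.excess g G.s ≤ G.value (σ'.arr .res) + r' := by
      intro hr
      have h₁ : G.value (σ'.arr .res) ≤ _ := hr _ h'.residual.isFlow
      have h₂ : 1 ≤ r := by
        have : (1 : ℝ) ≤ r := by linarith
        exact_mod_cast this
      refine ⟨r - 1, by omega, fun g hg => ?_⟩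
      have := hr g hg
      push_cast [h₂]
      linarith
    rcases hr with ⟨i, hi, rfl⟩ | hr
    · rcases Nat.eq_zero_or_pos i with rfl | hi₀
      · obtain ⟨r', h₁, h₂⟩ := hgain fun g hg => by
          rw [zero_add]
          exact h.level.value_le_add_div h.residual hG hk (by omega) hg
        exact ⟨r', h₁, .inr h₂⟩
      · by_cases ht' : σ'.arr .level G.t = 0
        · refine ⟨0, hi₀.trans_le (Nat.le_add_right _ _), .inr fun g hg => ?_⟩
          rw [Nat.cast_zero, add_zero]
          exact h'.level.optimal h'.residual ht' hg
        · have := hlev ht'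
          exact ⟨i - 1 + G.n / k, by omega, .inl ⟨i - 1, by omega, rfl⟩⟩
    · obtain ⟨r', h₁, h₂⟩ := hgain hr
      exact ⟨r', h₁, .inr h₂⟩
  · rintro τ σ' ⟨φ', ⟨h', -⟩, hb, hτ⟩
    have hb : ¬ ¬ σ'.arr .level (σ'.reg .t) = 0 := hb
    rw [not_not, h'.static.t] at hb
    simp only [Cond.cost, Expr.cost] at hτ
    have : (0 : Expr Reg Arr).cost = 1 := rfl
    exact ⟨by omega, h', hb⟩

/-- Dinic's algorithm on a numbered network of type 2. -/
theorem terminates_program {G : NumNet} (hG : G.IsType2) {σ : Store Reg Arr}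
    (n : σ.reg .n = G.n) (m : σ.reg .m = G.m) (s : σ.reg .s = G.s) (t : σ.reg .t = G.t)
    (tail : σ.arr .tail = G.tail) (head : σ.arr .head = G.head)
    (cap : ∀ i < G.m, σ.arr .cap i = 1) :
    Terminates program (fun τ σ' => τ ≤ 15000 * ((G.n + G.m + 1) * G.n.sqrt) ∧ ∃ res,
      G.IsResidual res ∧ (∀ g, G.IsFlow g → G.excess g G.s ≤ G.value res) ∧
      ∀ i < G.m, σ'.arr .flow i = res (i + G.m)) σ := by
  have hk : 0 < G.n.sqrt := Nat.sqrt_pos.2 (Nat.zero_lt_of_lt G.s_lt)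
  unfold program
  rw [terminates_seq]
  refine (terminates_build n m s t tail head cap).mono ?_
  rintro τ₁ σ₁ ⟨hτ₁, h₁, hres⟩
  have hres₁ : G.IsResidual (σ₁.arr .res) := by
    refine ⟨fun i hi => by rw [(hres i hi).1, (hres i hi).2], fun w _ _ => ?_⟩
    unfold NumNet.excess
    refine Finset.sum_eq_zero fun i hi => ?_
    simp [NumNet.flowOf, (hres i (Finset.mem_range.1 hi)).2]
  rw [terminates_seq]
  refine (terminates_bfs h₁).mono ?_
  rintro τ₂ σ₂ ⟨hτ₂, h₂, hr₂, hl₂⟩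
  rw [terminates_seq]
  refine (terminates_phases hG hk ⟨h₂, hr₂ ▸ hres₁, hr₂ ▸ hl₂⟩).mono ?_
  rintro τ₃ σ₃ ⟨hτ₃, h₃, ht₃⟩
  refine (terminates_forLoop (N := G.m) (c := 10) (e := .var .m) (fun j σ => σ.reg .i = j ∧
    Static G σ ∧ σ.arr .res = σ₃.arr .res ∧ ∀ i < j, σ.arr .flow i = σ₃.arr .res (i + G.m))
    (Nat.zero_le _) (fun j σ h => h.2.1.m) (fun j σ h => h.1) ?_ ?_).mono ?_
  · rintro j σ - hj ⟨h₄, h₅, h₆, h₇⟩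
    simp only [terminates_write, Store.setReg_reg, Store.setReg_arr, Store.setCell_reg,
      Store.setCell_arr, Expr.eval, Expr.cost, reduceCtorEq, if_true, if_false, h₄, h₅.m, h₆]
    refine ⟨by norm_num, trivial, h₅.congr rfl rfl rfl rfl rfl rfl rfl rfl, trivial, ?_⟩
    intro i hi
    by_cases h : i = j
    · rw [h, Function.update_self]
    · rw [Function.update_of_ne h]; exact h₇ i (by omega)
  · exact ⟨rfl, h₃.static.congr rfl rfl rfl rfl rfl rfl rfl rfl, rfl, by simp⟩
  · rintro τ₄ σ₄ ⟨hτ₄, -, -, -, hflow⟩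
    refine ⟨?_, _, h₃.residual, fun g hg => h₃.level.optimal h₃.residual ht₃ hg, hflow⟩
    -- With `k = ⌊√n⌋` there are at most `2 k + 4 ≤ 6 k` phases.
    set k := G.n.sqrt with hk'
    have hdiv : G.n / k ≤ k + 2 := by
      have h₄ : G.n < (k + 1) * (k + 1) := Nat.lt_succ_sqrt _
      rw [Nat.div_le_iff_le_mul_add_pred hk]
      nlinarith
    have h₅ : k + 2 + G.n / k ≤ 6 * k := by omega
    have h₆ := Nat.mul_le_mul_left (2210 * (G.n + G.m + 1)) h₅
    have h₇ := Nat.mul_le_mul_left (G.n + G.m + 1) hk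
    simp only [Expr.cost] at hτ₄
    have h₈ : 2210 * (G.n + G.m + 1) * (6 * k) = 13260 * ((G.n + G.m + 1) * k) := by ring
    omega

end Dinic

/-! ### Flow networks as numbered networks -/

namespace Dinic

open RAM

section Bridge

theorem sum_range_eq_sum_edges {W M : Type*} [AddCommMonoid M] {D : FlowNetwork W}
    (enum : D.edges ≃ Fin D.edges.card) (F : ℕ → M) :
    ∑ i ∈ Finset.range D.edges.card, F i = ∑ e : D.edges, F (enum e) := by
  rw [Finset.sum_range, ← Equiv.sum_comp enum]

variable {W : Type*} [Fintype W] {D : FlowNetwork W} {num : W ≃ Fin (Fintype.card W)}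
  {enum : D.edges ≃ Fin D.edges.card} {σ : Store Reg Arr}

/-- The numbered network that a memory holds. -/
def Holds.toNumNet (h : Holds D num enum σ) : NumNet where
  n := Fintype.card W
  m := D.edges.card
  s := num D.source
  t := num D.sink
  tail := σ.arr .tail
  head := σ.arr .head
  tail_lt i hi := by
    have := (h.2.2.2.2 (enum.symm ⟨i, hi⟩)).1
    rw [Equiv.apply_symm_apply] at this
    rw [this]
    exact Fin.isLt _
  head_lt i hi := by
    have := (h.2.2.2.2 (enum.symm ⟨i, hi⟩)).2.1
    rw [Equiv.apply_symm_apply] at this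
    rw [this]
    exact Fin.isLt _
  s_lt := Fin.isLt _
  t_lt := Fin.isLt _
  s_ne_t h := D.source_ne_sink (num.injective (Fin.ext h))

theorem val_num_inj {v w : W} : (num v : ℕ) = num w ↔ v = w := by
  rw [← Fin.ext_iff, num.injective.eq_iff]

variable [DecidableEq W]

theorem Holds.card_head (h : Holds D num enum σ) (w : W) :
    ((Finset.range h.toNumNet.m).filter fun i => h.toNumNet.head i = num w).card =
      (D.inEdges w).card := by
  rw [Finset.card_filter, FlowNetwork.inEdges, Finset.card_filter,
    ← Finset.sum_coe_sort D.edges]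
  refine (sum_range_eq_sum_edges enum _).trans (Finset.sum_congr rfl fun e _ => ?_)
  have : h.toNumNet.head (enum e) = num e.1.2 := (h.2.2.2.2 e).2.1
  simp only [this, val_num_inj]

theorem Holds.card_tail (h : Holds D num enum σ) (w : W) :
    ((Finset.range h.toNumNet.m).filter fun i => h.toNumNet.tail i = num w).card =
      (D.outEdges w).card := by
  rw [Finset.card_filter, FlowNetwork.outEdges, Finset.card_filter,
    ← Finset.sum_coe_sort D.edges]
  refine (sum_range_eq_sum_edges enum _).trans (Finset.sum_congr rfl fun e _ => ?_)
  have : h.toNumNet.tail (enum e) = num e.1.1 := (h.2.2.2.2 e).1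
  simp only [this, val_num_inj]

theorem Holds.isType2 (h : Holds D num enum σ) (hD : D.IsUnitType2) : h.toNumNet.IsType2 := by
  intro w hw hs ht
  obtain ⟨w, rfl⟩ : ∃ v, (num v : ℕ) = w := ⟨num.symm ⟨w, hw⟩, by simp⟩
  rw [h.card_head, h.card_tail]
  exact hD.2 w (fun hws => hs (by rw [hws]; rfl)) (fun hwt => ht (by rw [hwt]; rfl))

/-- The net flow out of a numbered vertex is that out of the vertex of the given network. -/
theorem Holds.excess_eq (h : Holds D num enum σ) {f : ℕ → ℝ} {g : W × W → ℝ}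
    (hfg : ∀ e : D.edges, f (enum e) = g e) (w : W) :
    h.toNumNet.excess f (num w) = ∑ e ∈ D.outEdges w, g e - ∑ e ∈ D.inEdges w, g e := by
  rw [FlowNetwork.outEdges, FlowNetwork.inEdges, Finset.sum_filter, Finset.sum_filter,
    ← Finset.sum_sub_distrib, ← Finset.sum_coe_sort D.edges]
  refine (sum_range_eq_sum_edges enum _).trans (Finset.sum_congr rfl fun e _ => ?_)
  have h₁ : h.toNumNet.tail (enum e) = num e.1.1 := (h.2.2.2.2 e).1
  have h₂ : h.toNumNet.head (enum e) = num e.1.2 := (h.2.2.2.2 e).2.1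
  rw [hfg, h₁, h₂]
  simp only [val_num_inj]
  split_ifs <;> ring

theorem Holds.flowValue_eq (h : Holds D num enum σ) {f : ℕ → ℝ} {g : W × W → ℝ}
    (hfg : ∀ e : D.edges, f (enum e) = g e) :
    h.toNumNet.excess f h.toNumNet.s = D.flowValue g := by
  have h₁ : D.inEdges D.source = ∅ :=
    Finset.filter_eq_empty_iff.2 fun e he => D.no_edge_into_source e he
  refine (h.excess_eq hfg D.source).trans ?_
  rw [h₁, Finset.sum_empty, sub_zero, FlowNetwork.flowValue]

theorem Holds.isFlow_iff (h : Holds D num enum σ) (hD : D.IsUnitType2) {f : ℕ → ℝ}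
    {g : W × W → ℝ} (hfg : ∀ e : D.edges, f (enum e) = g e) :
    h.toNumNet.IsFlow f ↔ D.IsFeasibleFlow g := by
  have hcap : ∀ e ∈ D.edges, (D.cap e : ℝ) = 1 := fun e he => by rw [hD.1 e he, Nat.cast_one]
  constructor
  · intro hf
    refine ⟨fun e he => ?_, fun w hs ht => ?_⟩
    · rw [hcap e he, ← hfg ⟨e, he⟩]
      exact ⟨hf.nonneg _ (Fin.isLt _), hf.le_one _ (Fin.isLt _)⟩
    · have := hf.conserved (num w) (fun h => hs (val_num_inj.1 h)) (fun h => ht (val_num_inj.1 h))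
      rw [h.excess_eq hfg] at this
      exact sub_eq_zero.1 this
  · intro hg
    have key : ∀ i < D.edges.card, 0 ≤ f i ∧ f i ≤ 1 := by
      intro i hi
      have h₁ := hfg (enum.symm ⟨i, hi⟩)
      rw [Equiv.apply_symm_apply] at h₁
      have h₂ := hg.1 _ (enum.symm ⟨i, hi⟩).2
      rw [hcap _ (enum.symm ⟨i, hi⟩).2] at h₂
      rwa [h₁]
    refine ⟨fun i hi => (key i hi).1, fun i hi => (key i hi).2, fun w hs ht => ?_⟩
    by_cases hw : w < Fintype.card W
    · obtain ⟨w, rfl⟩ : ∃ v, (num v : ℕ) = w := ⟨num.symm ⟨w, hw⟩, by simp⟩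
      rw [h.excess_eq hfg, hg.2 w (fun hws => hs (by rw [hws]; rfl))
        (fun hwt => ht (by rw [hwt]; rfl)), sub_self]
    · refine Finset.sum_eq_zero fun i hi => ?_
      have hi := Finset.mem_range.1 hi
      have h₁ : h.toNumNet.tail i ≠ w := ne_of_mem_of_not_mem (s := Set.Iio _)
        (h.toNumNet.tail_lt i hi) hw
      have h₂ : h.toNumNet.head i ≠ w := ne_of_mem_of_not_mem (s := Set.Iio _)
        (h.toNumNet.head_lt i hi) hw
      rw [if_neg h₁, if_neg h₂, sub_self, mul_zero]

/-- Dinic's algorithm finds a maximum flow in a network of type 2. -/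
theorem Holds.terminates (h : Holds D num enum σ) (hD : D.IsUnitType2) :
    Terminates program (fun τ σ' =>
      τ ≤ 15000 * ((Fintype.card W + D.edges.card + 1) * (Fintype.card W).sqrt) ∧
      D.IsMaximumFlow (outputFlow D enum σ')) σ := by
  refine (terminates_program (h.isType2 hD) h.1 h.2.1 h.2.2.1 h.2.2.2.1 rfl rfl ?_).mono ?_
  · intro i hi
    have := (h.2.2.2.2 (enum.symm ⟨i, hi⟩)).2.2
    rwa [Equiv.apply_symm_apply, hD.1 _ (enum.symm ⟨i, hi⟩).2] at this
  · rintro τ σ' ⟨hτ, res, hres, hmax, hflow⟩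
    have hf : ∀ e : D.edges, h.toNumNet.flowOf res (enum e) = outputFlow D enum σ' e := by
      intro e
      have h₁ := hflow (enum e) (Fin.isLt _)
      rw [outputFlow, dif_pos e.2, Subtype.coe_eta, h₁]
      rfl
    refine ⟨hτ, (h.isFlow_iff hD hf).1 hres.isFlow, fun g hg => ?_⟩
    let g' : ℕ → ℝ := fun i => if hi : i < D.edges.card then g (enum.symm ⟨i, hi⟩) else 0
    have hg' : ∀ e : D.edges, g' (enum e) = g e := by
      intro e
      simp only [g', Fin.isLt, dif_pos, Fin.eta, Equiv.symm_apply_apply]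
    rw [← h.flowValue_eq hg', ← h.flowValue_eq hf]
    exact hmax g' ((h.isFlow_iff hD hg').2 hg)

end Bridge

end Dinic

/-! ### The network of MFTP -/

section Mftp

variable {V : Type*} [Fintype V]

theorem card_splitVertex : Fintype.card (SplitVertex V) = 2 * Fintype.card V + 2 := by
  let e : SplitVertex V ≃ (V ⊕ V) ⊕ Bool :=
    { toFun := fun
        | .vs => .inr false
        | .vt => .inr true
        | .vin v => .inl (.inl v)
        | .vout v => .inl (.inr v)
      invFun := fun
        | .inr false => .vs
        | .inr true => .vt
        | .inl (.inl v) => .vin v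
        | .inl (.inr v) => .vout v
      left_inv := by rintro (_ | _ | _ | _) <;> rfl
      right_inv := by rintro ((_ | _) | (_ | _)) <;> rfl }
  rw [Fintype.card_congr e]
  simp only [Fintype.card_sum, Fintype.card_bool]
  omega

variable [DecidableEq V] (E : Finset (V × V)) (S : Finset V)

theorem mem_edges_mftpNetwork (e : SplitVertex V × SplitVertex V) :
    e ∈ (mftpNetwork E S).edges ↔ (∃ v ∈ S, (.vt, .vout v) = e) ∨ (∃ v ∈ S, (.vin v, .vs) = e) ∨
      (∃ v, v ∉ S ∧ (.vin v, .vout v) = e) ∨ ∃ d ∈ E, (.vout d.1, .vin d.2) = e := by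
  simp only [mftpNetwork, Finset.mem_union, Finset.mem_image, Finset.mem_compl, or_assoc]

theorem mftpNetwork_isUnitType2 : (mftpNetwork E S).IsUnitType2 := by
  refine ⟨fun _ _ => rfl, fun w hs ht => ?_⟩
  cases w with
  | vs => exact absurd rfl ht
  | vt => exact absurd rfl hs
  | vin v =>
    right
    rw [Finset.card_eq_one]
    by_cases hv : v ∈ S
    · refine ⟨(.vin v, .vs), ?_⟩
      ext ⟨x, y⟩
      simp only [FlowNetwork.outEdges, Finset.mem_filter, mem_edges_mftpNetwork]
      aesop
    · refine ⟨(.vin v, .vout v), ?_⟩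
      ext ⟨x, y⟩
      simp only [FlowNetwork.outEdges, Finset.mem_filter, mem_edges_mftpNetwork]
      aesop
  | vout v =>
    left
    rw [Finset.card_eq_one]
    by_cases hv : v ∈ S
    · refine ⟨(.vt, .vout v), ?_⟩
      ext ⟨x, y⟩
      simp only [FlowNetwork.inEdges, Finset.mem_filter, mem_edges_mftpNetwork]
      aesop
    · refine ⟨(.vin v, .vout v), ?_⟩
      ext ⟨x, y⟩
      simp only [FlowNetwork.inEdges, Finset.mem_filter, mem_edges_mftpNetwork]
      aesop

/-- Each node has an edge that leaves its copy `vin v`. -/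
theorem card_le_card_edges_mftpNetwork :
    Fintype.card V ≤ (mftpNetwork E S).edges.card := by
  rw [← Finset.card_univ]
  refine Finset.card_le_card_of_injOn (fun v => (.vin v, if v ∈ S then .vs else .vout v)) ?_ ?_
  · intro v _
    simp only [Finset.mem_coe, mem_edges_mftpNetwork]
    by_cases hv : v ∈ S <;> simp [hv]
  · intro v _ w _ h
    exact SplitVertex.vin.inj (Prod.ext_iff.1 h).1

theorem card_edges_mftpNetwork_le :
    (mftpNetwork E S).edges.card ≤ 2 * Fintype.card V + E.card := by
  have h₁ : (S.image fun v => ((.vt, .vout v) : SplitVertex V × SplitVertex V)).card ≤ S.card :=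
    Finset.card_image_le
  have h₂ : (S.image fun v => ((.vin v, .vs) : SplitVertex V × SplitVertex V)).card ≤ S.card :=
    Finset.card_image_le
  have h₃ : (Sᶜ.image fun v => ((.vin v, .vout v) : SplitVertex V × SplitVertex V)).card ≤
      Sᶜ.card := Finset.card_image_le
  have h₄ : (E.image fun e => ((.vout e.1, .vin e.2) : SplitVertex V × SplitVertex V)).card ≤
      E.card := Finset.card_image_le
  have h₅ := Finset.card_add_card_compl S
  have h₆ := Finset.card_le_univ S
  refine (Finset.card_union_le _ _).trans ?_
  refine (Nat.add_le_add ((Finset.card_union_le _ _).trans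
    (Nat.add_le_add ((Finset.card_union_le _ _).trans (Nat.add_le_add h₁ h₂)) h₃)) h₄).trans ?_
  omega

end Mftp

theorem theorem4 :
    (∀ (V : Type*) [Fintype V] [DecidableEq V] (E : Finset (V × V)) (S : Finset V),
      (mftpNetwork E S).IsUnitType2) ∧
    ∃ C : ℝ, ∀ (V : Type*) [Fintype V] [DecidableEq V] [Nonempty V]
      (E : Finset (V × V)) (S : Finset V)
      (num : SplitVertex V ≃ Fin (Fintype.card (SplitVertex V)))
      (enum : (mftpNetwork E S).edges ≃ Fin (mftpNetwork E S).edges.card)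
      (σ : RAM.Store Dinic.Reg Dinic.Arr),
      Dinic.Holds (mftpNetwork E S) num enum σ →
      ∃ (τ : ℕ) (σ' : RAM.Store Dinic.Reg Dinic.Arr),
        RAM.Runs Dinic.program σ τ σ' ∧
        (mftpNetwork E S).IsMaximumFlow (Dinic.outputFlow (mftpNetwork E S) enum σ') ∧
        (τ : ℝ) ≤ C * (√(Fintype.card (SplitVertex V) : ℝ) *
          ((mftpNetwork E S).edges.card : ℝ)) ∧
        (Fintype.card V ≤ 2 * E.card →
          (τ : ℝ) ≤ C * (√(Fintype.card V : ℝ) * (E.card : ℝ))) := by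
  refine ⟨fun V _ _ E S => mftpNetwork_isUnitType2 E S, 900000, ?_⟩
  intro V _ _ _ E S num enum σ h
  obtain ⟨τ, σ', hrun, hτ, hmax⟩ := h.terminates (mftpNetwork_isUnitType2 E S)
  refine ⟨τ, σ', hrun, hmax, ?_⟩
  have hm := card_le_card_edges_mftpNetwork E S
  have hm' := card_edges_mftpNetwork_le E S
  have hn := card_splitVertex (V := V)
  have hV := Fintype.card_pos (α := V)
  set n := Fintype.card (SplitVertex V)
  set m := (mftpNetwork E S).edges.card
  have h₁ : τ ≤ 90000 * (n.sqrt * m) := by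
    have h₂ : n + m + 1 ≤ 6 * m := by omega
    have h₃ := Nat.mul_le_mul_right n.sqrt h₂
    have h₄ : 6 * m * n.sqrt = 6 * (n.sqrt * m) := by ring
    omega
  have h₂ : (τ : ℝ) ≤ 90000 * (√(n : ℝ) * m) := by
    refine (Nat.cast_le.2 h₁).trans ?_
    push_cast
    gcongr
    exact Real.nat_sqrt_le_real_sqrt
  -- The constants: `√(2 |V| + 2) ≤ 2 √|V|`, and the network has at most `5 |E|` edges if
  -- `|V| ≤ 2 |E|`.
  constructor
  · refine h₂.trans (mul_le_mul_of_nonneg_right (by norm_num) (by positivity))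
  · intro hE
    have h₃ : √(n : ℝ) ≤ 2 * √(Fintype.card V : ℝ) := by
      rw [Real.sqrt_le_left (by positivity), mul_pow, Real.sq_sqrt (by positivity)]
      have : n ≤ 4 * Fintype.card V := by omega
      have : (n : ℝ) ≤ 4 * Fintype.card V := by exact_mod_cast this
      linarith
    have h₄ : (m : ℝ) ≤ 5 * E.card := by
      have : m ≤ 5 * E.card := by omega
      exact_mod_cast this
    calc (τ : ℝ) ≤ 90000 * (√(n : ℝ) * m) := h₂
      _ ≤ 90000 * (2 * √(Fintype.card V : ℝ) * (5 * E.card)) := by gcongr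
      _ = 900000 * (√(Fintype.card V : ℝ) * E.card) := by ring
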